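/- Let $A\in\mathbb{R}^{n\times n}$, $C\in\mathbb{R}^{m\times n}$, let $Q\in\mathbb{R}^{n\times n}$ be symmetric positive semidefinite and $R\in\mathbb{R}^{m\times m}$ symmetric positive definite, and let $0<p_l<1$, $0<q_l<1$ for $l=1,\dots,m$ (failure and recovery rates of $m$ independent two-state Markovian packet-drop channels). Put $$P_l=\begin{bmatrix}1-q_l&q_l\\ p_l&1-p_l\end{bmatrix},\qquad \pi_l=\Big[\tfrac{p_l}{p_l+q_l}\ \ \tfrac{q_l}{p_l+q_l}\Big],\qquad N=2^m .$$ A mode $i\in\{1,\dots,N\}$ encodes arrival indicators $\gamma_1,\dots,\gamma_m\in\{0,1\}$ through $i=1+\sum_{l=1}^m 2^{l-1}\gamma_l$, and $H_i=\mathrm{diag}\{\gamma_1,\dots,\gamma_m\}\,C$. The mode chain has transition matrix $[p_{ij}]=P_m\otimes\cdots\otimes P_1$ and stationary distribution $\mu=[\mu_1\ \cdots\ \mu_N]=\pi_m\otimes\cdots\otimes\pi_1$. For $L=(L_1,\dots,L_N)$ with $L_i\in\mathbb{R}^{n\times m}$, let $\widetilde{\mathcal L}$ be the operator on $N$-tuples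 of real $n\times n$ matrices given by $\widetilde{\mathcal L}_j(V)=\sum_{i=1}^N p_{ij}(A+L_iH_i)V_i(A+L_iH_i)'$, and let $\rho$ denote the spectral radius (largest modulus of a complex eigenvalue). The jump system $(\mathbf H,\mathbf A,\mathbf p)$ is mean-square (MS) detectable if $\rho(\widetilde{\mathcal L})<1$ for some $L$. The filtering coupled algebraic Riccati equations (CAREs) are $$Y_j=\sum_{i=1}^N p_{ij}\big[AY_iA'-AY_iH_i'(H_iY_iH_i'+\mu_iR)^{-1}H_iY_iA'+\mu_iQ\big],\qquad j=1,\dots,N.$$ A tuple $Y=(Y_1,\dots,Y_N)$ of symmetric positive semidefinite matrices that solves the CAREs is an MS stabilizing solution if $\rho(\widetilde{\mathcal L})<1$ for $L_i=-AY_iH_i'(H_iY_iH_i'+\mu_iR)^{-1}$, $i=1,\dots,N$. Theorem. The CAREs have an MS stabilizing solution if and only if 1) $(\mathbf H,\mathbf A,\mathbf p)$ is MS detectable, and 2) $(A,Q)$ has no uncontrollable eigenvalue on the unit circle, i.e. $\mathrm{rank}\,[\lambda I_n-A\ \ Q]=n$ for all $\lambda\in\mathbb{C}$ with $|\lambda|=1$.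 -/

import Mathlib

open scoped Matrix TensorProduct ENNReal

noncomputable section

namespace JumpFilter

/-- The arrival indicators `(γ₁, …, γₘ)` of a mode. Modes are numbered from `0` to `2 ^ m - 1` by
`θ = ∑ l, γ l * 2 ^ l`, that is, `γ` lists the binary digits of `θ`. -/
def arrival {m : ℕ} (θ : Fin (2 ^ m)) : Fin m → Fin 2 :=
  finFunctionFinEquiv.symm θ

/-- Transition matrix of a single packet-drop channel with failure rate `p` and recovery rate `q`;
state `0` is "dropped" and state `1` is "received". -/
def channelTPM (p q : ℝ) : Matrix (Fin 2) (Fin 2) ℝ :=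
  !![1 - q, q; p, 1 - p]

/-- Limit distribution of a single packet-drop channel. -/
def channelDist (p q : ℝ) : Fin 2 → ℝ :=
  ![p / (p + q), q / (p + q)]

/-- Transition matrix `P = Pₘ ⊗ ⋯ ⊗ P₁` of the mode chain: the `m` channels evolve
independently. -/
def modeTPM {m : ℕ} (p q : Fin m → ℝ) : Matrix (Fin (2 ^ m)) (Fin (2 ^ m)) ℝ :=
  Matrix.of fun i j => ∏ l, channelTPM (p l) (q l) (arrival i l) (arrival j l)

/-- Stationary distribution `μ = πₘ ⊗ ⋯ ⊗ π₁` of the mode chain. -/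
def modeDist {m : ℕ} (p q : Fin m → ℝ) : Fin (2 ^ m) → ℝ :=
  fun i => ∏ l, channelDist (p l) (q l) (arrival i l)

/-- The output matrix `H_θ = Γ C`, `Γ = diag(γ₁, …, γₘ)`, of a mode. -/
def modeOutput {m n : ℕ} (C : Matrix (Fin m) (Fin n) ℝ) (θ : Fin (2 ^ m)) :
    Matrix (Fin m) (Fin n) ℝ :=
  Matrix.diagonal (fun l => ((arrival θ l : ℕ) : ℝ)) * C

/-- The spectral radius of an operator on a real vector space: the supremum of the moduli of the
complex spectrum, i.e. of the spectrum of the complexification. -/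
def spectralRad {E : Type*} [AddCommGroup E] [Module ℝ E] (T : E →ₗ[ℝ] E) : ℝ≥0∞ :=
  spectralRadius ℂ (A := Module.End ℂ (ℂ ⊗[ℝ] E)) (LinearMap.baseChange ℂ T)

/-- The operator `V ↦ (∑ i, P i j • F i * V i * (F i)ᵀ)_j` on tuples of real matrices. -/
def jumpOperator {ι : Type*} [Fintype ι] {n : ℕ} (P : Matrix ι ι ℝ)
    (F : ι → Matrix (Fin n) (Fin n) ℝ) :
    (ι → Matrix (Fin n) (Fin n) ℝ) →ₗ[ℝ] (ι → Matrix (Fin n) (Fin n) ℝ) where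
  toFun V j := ∑ i, P i j • (F i * V i * (F i)ᵀ)
  map_add' V W := by
    funext j
    simp [mul_add, add_mul, Finset.sum_add_distrib]
  map_smul' c V := by
    funext j
    simp [Finset.smul_sum, smul_comm c]

/-- Mean-square detectability of the jump system `(H, A, P)`. -/
def IsMSDetectable {ι : Type*} [Fintype ι] {m n : ℕ} (H : ι → Matrix (Fin m) (Fin n) ℝ)
    (A : ι → Matrix (Fin n) (Fin n) ℝ) (P : Matrix ι ι ℝ) : Prop :=
  ∃ L : ι → Matrix (Fin n) (Fin m) ℝ, spectralRad (jumpOperator P fun i => A i + L i * H i) < 1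

/-- The gains `K_i(Y) = A Y_i H_iᵀ (H_i Y_i H_iᵀ + μ_i R)⁻¹`. -/
def gain {ι : Type*} {m n : ℕ} (A : Matrix (Fin n) (Fin n) ℝ)
    (H : ι → Matrix (Fin m) (Fin n) ℝ) (R : Matrix (Fin m) (Fin m) ℝ) (μ : ι → ℝ)
    (Y : ι → Matrix (Fin n) (Fin n) ℝ) (i : ι) : Matrix (Fin n) (Fin m) ℝ :=
  A * Y i * (H i)ᵀ * (H i * Y i * (H i)ᵀ + μ i • R)⁻¹

/-- `Y` solves the filtering coupled algebraic Riccati equations. -/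
def SolvesCARE {ι : Type*} [Fintype ι] {m n : ℕ} (A : Matrix (Fin n) (Fin n) ℝ)
    (H : ι → Matrix (Fin m) (Fin n) ℝ) (Q : Matrix (Fin n) (Fin n) ℝ)
    (R : Matrix (Fin m) (Fin m) ℝ) (P : Matrix ι ι ℝ) (μ : ι → ℝ)
    (Y : ι → Matrix (Fin n) (Fin n) ℝ) : Prop :=
  ∀ j, Y j = ∑ i, P i j •
    (A * Y i * Aᵀ
      - A * Y i * (H i)ᵀ * (H i * Y i * (H i)ᵀ + μ i • R)⁻¹ * (H i * Y i * Aᵀ)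
      + μ i • Q)

/-- `Y` is a mean-square stabilizing solution of the filtering coupled algebraic Riccati
equations: a tuple of positive semidefinite matrices that solves them and whose gains make the
error operator stable. -/
structure IsMSStabilizingSolution {ι : Type*} [Fintype ι] {m n : ℕ}
    (A : Matrix (Fin n) (Fin n) ℝ) (H : ι → Matrix (Fin m) (Fin n) ℝ)
    (Q : Matrix (Fin n) (Fin n) ℝ) (R : Matrix (Fin m) (Fin m) ℝ) (P : Matrix ι ι ℝ)
    (μ : ι → ℝ) (Y : ι → Matrix (Fin n) (Fin n) ℝ) : Prop where
  posSemidef : ∀ i, (Y i).PosSemidef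
  solves : SolvesCARE A H Q R P μ Y
  stable : spectralRad (jumpOperator P fun i => A + (-gain A H R μ Y i) * H i) < 1

end JumpFilter

end

/-
Perturbing `Q` to a positive definite matrix makes every step of Kleinman's policy iteration,
started from a detecting gain, a stable filter whose stationary covariances decrease; letting the
perturbation tend to zero along the iteration gives a solution `Y` of the Riccati equations whose
error operator is a limit of stable ones. Such a limit is stable unless its adjoint has a nonzero
nonnegative fixed tuple `U`. For the trace pairing, a fixed tuple of the adjoint is orthogonal to
the noise term of the Riccati equation, so averaging `U` with the weights `μ` yields a nonzero
positive semidefinite `S` with `Aᵀ * S * A = S` and `S * Q = 0`. Such an `S` exists exactly when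
`(A, Q)` has an uncontrollable eigenvalue on the unit circle. Conversely, for a stabilizing `Y` the
constant tuple `S` is fixed by the adjoint of its error operator, which forces `S = 0`.
-/

noncomputable section

namespace JumpFilter

open Filter Topology Matrix
open scoped MatrixOrder

section SpectralRadius

lemma spectralRadius_lt_one_iff_tendsto_pow {𝔸 : Type*} [NormedRing 𝔸] [NormedAlgebra ℂ 𝔸]
    [CompleteSpace 𝔸] (a : 𝔸) :
    spectralRadius ℂ a < 1 ↔ Tendsto (fun k : ℕ => a ^ k) atTop (𝓝 0) := by
  constructor
  · intro h
    obtain ⟨r, har, hr⟩ := exists_between h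
    have hle : ∀ᶠ k : ℕ in atTop, (‖a ^ k‖₊ : ℝ≥0∞) ≤ r ^ k := by
      filter_upwards [eventually_gt_atTop 0,
        (spectrum.pow_nnnorm_pow_one_div_tendsto_nhds_spectralRadius a).eventually_lt_const har]
        with k hk hlt
      have hpow := pow_le_pow_left' hlt.le k
      rwa [← ENNReal.rpow_natCast, ← ENNReal.rpow_mul, one_div,
        inv_mul_cancel₀ (by exact_mod_cast hk.ne'), ENNReal.rpow_one] at hpow
    have hnorm : Tendsto (fun k : ℕ => (‖a ^ k‖₊ : ℝ≥0∞)) atTop (𝓝 0) :=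
      tendsto_of_tendsto_of_tendsto_of_le_of_le' tendsto_const_nhds
        (ENNReal.tendsto_pow_atTop_nhds_zero_of_lt_one hr) (.of_forall fun _ => zero_le) hle
    exact tendsto_zero_iff_norm_tendsto_zero.2 (NNReal.tendsto_coe.2 (ENNReal.tendsto_coe.1 hnorm))
  · intro h
    have hlim : Tendsto (fun k : ℕ => ‖a ^ (k + 1)‖₊ * ‖(1 : 𝔸)‖₊) atTop (𝓝 0) := by
      simpa using ((h.comp (tendsto_add_atTop_nat 1)).nnnorm).mul_const ‖(1 : 𝔸)‖₊
    obtain ⟨k, hk⟩ := (hlim.eventually_lt_const one_pos).exists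
    refine (spectrum.spectralRadius_le_pow_nnnorm_pow_one_div ℂ a k).trans_lt ?_
    rw [← ENNReal.mul_rpow_of_nonneg _ _ (by positivity)]
    exact ENNReal.rpow_lt_one (by exact_mod_cast hk) (by positivity)

/-- Schur stability of a discrete-time linear system `x ↦ T x`: every trajectory tends to zero. -/
def IsSchurStable {E : Type*} [AddCommGroup E] [Module ℝ E] [TopologicalSpace E]
    (T : E →ₗ[ℝ] E) : Prop :=
  ∀ x, Tendsto (fun k : ℕ => (T ^ k) x) atTop (𝓝 0)

section FiniteDimensional

variable {E : Type*} [AddCommGroup E] [Module ℝ E] {κ : Type*} [Fintype κ] [DecidableEq κ]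

lemma spectralRad_eq_spectralRadius_toMatrix (b : Module.Basis κ ℝ E) (T : E →ₗ[ℝ] E) :
    spectralRad T = spectralRadius ℂ ((LinearMap.toMatrix b b T).map (algebraMap ℝ ℂ)) := by
  rw [spectralRad, spectralRadius, spectralRadius, ← LinearMap.toMatrix_baseChange,
    LinearMap.spectrum_toMatrix]

variable [TopologicalSpace E] [IsTopologicalAddGroup E] [ContinuousSMul ℝ E] [T2Space E]

lemma isSchurStable_iff_tendsto_toMatrix_pow (b : Module.Basis κ ℝ E) (T : E →ₗ[ℝ] E) :
    IsSchurStable T ↔ Tendsto (fun k : ℕ => LinearMap.toMatrix b b T ^ k) atTop (𝓝 0) := by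
  have : FiniteDimensional ℝ E := b.finiteDimensional_of_finite
  simp only [LinearMap.toMatrix_pow]
  constructor
  · intro h
    have hcont : Continuous b.equivFun := b.equivFun.toLinearMap.continuous_of_finiteDimensional
    refine tendsto_pi_nhds.2 fun i => tendsto_pi_nhds.2 fun j => ?_
    simpa [LinearMap.toMatrix_apply] using tendsto_pi_nhds.1 ((hcont.tendsto 0).comp (h (b j))) i
  · intro h x
    have hcont : Continuous fun M : Matrix κ κ ℝ => b.equivFun.symm (M *ᵥ b.equivFun x) :=
      b.equivFun.symm.toLinearMap.continuous_of_finiteDimensional.comp (by fun_prop)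
    have hlim := (hcont.tendsto 0).comp h
    simp only [Matrix.zero_mulVec, map_zero] at hlim
    refine hlim.congr fun k => (LinearEquiv.symm_apply_eq _).2 ?_
    exact LinearMap.toMatrix_mulVec_repr b b (T ^ k) x

open scoped Matrix.Norms.Operator in
lemma spectralRad_lt_one_iff_isSchurStable [FiniteDimensional ℝ E] (T : E →ₗ[ℝ] E) :
    spectralRad T < 1 ↔ IsSchurStable T := by
  let b := Module.finBasis ℝ E
  have hpow (k : ℕ) : (LinearMap.toMatrix b b T).map (algebraMap ℝ ℂ) ^ k
      = (LinearMap.toMatrix b b T ^ k).map (algebraMap ℝ ℂ) :=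
    (map_pow (algebraMap ℝ ℂ).mapMatrix _ k).symm
  rw [spectralRad_eq_spectralRadius_toMatrix b, spectralRadius_lt_one_iff_tendsto_pow,
    isSchurStable_iff_tendsto_toMatrix_pow b]
  simp only [hpow]
  refine tendsto_pi_nhds.trans (.trans (forall_congr' fun i => ?_) tendsto_pi_nhds.symm)
  refine tendsto_pi_nhds.trans (.trans (forall_congr' fun j => ?_) tendsto_pi_nhds.symm)
  exact Filter.tendsto_ofReal_iff

end FiniteDimensional

end SpectralRadius

section SchurStable

variable {E : Type*} [AddCommGroup E] [Module ℝ E] [TopologicalSpace E] {T : E →ₗ[ℝ] E}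

/-- The solution `x` of the Lyapunov equation `x = T x + g`; it is `0` when `1 - T` is not
invertible. -/
def lyapunovSolution (T : E →ₗ[ℝ] E) (g : E) : E := Ring.inverse (1 - T) g

lemma IsSchurStable.eq_zero_of_map_eq [T2Space E] (hT : IsSchurStable T) {x : E} (hx : T x = x) :
    x = 0 := by
  refine tendsto_nhds_unique (tendsto_const_nhds.congr fun k => ?_) (hT x)
  rw [Module.End.pow_apply, Function.IsFixedPt.iterate hx k]

lemma IsSchurStable.isUnit_one_sub [T2Space E] [FiniteDimensional ℝ E] (hT : IsSchurStable T) :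
    IsUnit (1 - T) := by
  rw [LinearMap.isUnit_iff_ker_eq_bot, LinearMap.ker_eq_bot']
  exact fun x hx => hT.eq_zero_of_map_eq (sub_eq_zero.1 hx).symm

lemma IsSchurStable.map_lyapunovSolution_add [T2Space E] [FiniteDimensional ℝ E]
    (hT : IsSchurStable T) (g : E) : T (lyapunovSolution T g) + g = lyapunovSolution T g := by
  have hinv := LinearMap.congr_fun (Ring.mul_inverse_cancel _ hT.isUnit_one_sub) g
  exact (sub_eq_iff_eq_add'.1 hinv).symm

lemma IsSchurStable.nonneg_of_map_le [PartialOrder E] [OrderClosedTopology E]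
    (hT : IsSchurStable T) (hmono : Monotone T) {x : E} (hx : T x ≤ x) : 0 ≤ x := by
  refine le_of_tendsto' (hT x) fun k => ?_
  rw [Module.End.pow_apply]
  exact hmono.antitone_iterate_of_map_le hx k.zero_le

lemma IsSchurStable.lyapunovSolution_nonneg [T2Space E] [FiniteDimensional ℝ E] [PartialOrder E]
    [IsOrderedAddMonoid E] [OrderClosedTopology E] (hT : IsSchurStable T) (hmono : Monotone T)
    {g : E} (hg : 0 ≤ g) : 0 ≤ lyapunovSolution T g := by
  refine hT.nonneg_of_map_le hmono ?_
  conv_rhs => rw [← hT.map_lyapunovSolution_add g]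
  exact le_add_of_nonneg_right hg

end SchurStable

section RealMatrix

variable {κ ν : Type*}

lemma isClosed_setOf_posSemidef [Finite κ] : IsClosed {X : Matrix κ κ ℝ | X.PosSemidef} := by
  have := Fintype.ofFinite κ
  simp only [posSemidef_iff_dotProduct_mulVec, IsHermitian, Set.ofPred_and, Set.ofPred_forall]
  exact (isClosed_eq (by fun_prop) continuous_id).inter
    (isClosed_iInter fun x => isClosed_le continuous_const (by fun_prop))

instance [Finite κ] : OrderClosedTopology (Matrix κ κ ℝ) where
  isClosed_le' := isClosed_setOf_posSemidef.preimage (continuous_snd.sub continuous_fst)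

lemma eventually_smul_one_add_nonneg [Finite κ] [DecidableEq κ] {X : Matrix κ κ ℝ}
    (hX : X.IsHermitian) : ∀ᶠ c : ℝ in atTop, 0 ≤ c • 1 + X := by
  have := Fintype.ofFinite κ
  obtain ⟨b, hb⟩ := X.finite_real_spectrum.bddBelow
  filter_upwards [eventually_ge_atTop (-b)] with c hc
  have hle : algebraMap ℝ (Matrix κ κ ℝ) (-c) ≤ X :=
    algebraMap_le_of_le_spectrum (fun x hx => (neg_le.1 hc).trans (hb hx)) hX
  rwa [Algebra.algebraMap_eq_smul_one, neg_smul, neg_le_iff_add_nonneg'] at hle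

variable [Fintype κ]

lemma posSemidef_mul_mul_transpose [Finite ν] {X : Matrix κ κ ℝ} (hX : X.PosSemidef)
    (B : Matrix ν κ ℝ) : (B * X * Bᵀ).PosSemidef := by
  simpa using hX.mul_mul_conjTranspose_same B

lemma abs_apply_le_trace {X : Matrix κ κ ℝ} (hX : X.PosSemidef) (a b : κ) :
    |X a b| ≤ X.trace := by
  classical
  have hdiag (c : κ) : X c c ≤ X.trace :=
    Finset.single_le_sum (f := fun c => X c c) (fun c _ => hX.diag_nonneg) (Finset.mem_univ c)
  have hsymm : X b a = X a b := hX.isHermitian.apply a b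
  have hadd := hX.dotProduct_mulVec_nonneg (Pi.single a 1 + Pi.single b 1)
  have hsub := hX.dotProduct_mulVec_nonneg (Pi.single a 1 - Pi.single b 1)
  simp only [star_trivial, mulVec_add, mulVec_sub, mulVec_single, MulOpposite.op_one, one_smul,
    dotProduct_add, dotProduct_sub, add_dotProduct, sub_dotProduct, single_dotProduct, col_apply,
    one_mul, hsymm] at hadd hsub
  rw [abs_le]
  constructor <;> linarith [hdiag a, hdiag b]

lemma exists_eq_transpose_mul_self {X : Matrix κ κ ℝ} (hX : X.PosSemidef) :
    ∃ B : Matrix κ κ ℝ, X = Bᵀ * B := by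
  classical
  simpa [star_eq_conjTranspose] using CStarAlgebra.nonneg_iff_eq_star_mul_self.1 hX.nonneg

lemma trace_mul_nonneg {U V : Matrix κ κ ℝ} (hU : U.PosSemidef) (hV : V.PosSemidef) :
    0 ≤ (U * V).trace := by
  obtain ⟨B, rfl⟩ := exists_eq_transpose_mul_self hU
  rw [mul_assoc, trace_mul_comm]
  exact (posSemidef_mul_mul_transpose hV B).trace_nonneg

lemma mul_eq_zero_of_trace_mul_eq_zero {U V : Matrix κ κ ℝ} (hU : U.PosSemidef)
    (hV : V.PosSemidef) (h : (U * V).trace = 0) : U * V = 0 := by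
  obtain ⟨B, rfl⟩ := exists_eq_transpose_mul_self hU
  obtain ⟨D, rfl⟩ := exists_eq_transpose_mul_self hV
  have hBD : D * Bᵀ = 0 := by
    rw [← trace_conjTranspose_mul_self_eq_zero_iff, ← h, mul_assoc Bᵀ, trace_mul_comm Bᵀ]
    simp [mul_assoc]
  rw [← transpose_eq_zero, transpose_mul, transpose_transpose] at hBD
  rw [mul_assoc, ← mul_assoc B, hBD, zero_mul, mul_zero]

lemma mul_eq_zero_of_trace_mul_conj_posDef_eq_zero [Fintype ν]
    {U : Matrix κ κ ℝ} {M : Matrix ν ν ℝ} {K : Matrix κ ν ℝ} (hU : U.PosSemidef) (hM : M.PosDef)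
    (h : (U * (K * M * Kᵀ)).trace = 0) : U * K = 0 := by
  obtain ⟨B, rfl⟩ := exists_eq_transpose_mul_self hU
  classical
  have hprod : (B * K)ᵀ * (B * K) * M = 0 := by
    refine mul_eq_zero_of_trace_mul_eq_zero (posSemidef_conjTranspose_mul_self _) hM.posSemidef ?_
    rw [← h]
    simp only [transpose_mul, Matrix.mul_assoc]
    rw [trace_mul_comm Kᵀ]
    simp only [Matrix.mul_assoc]
  have hBK : B * K = 0 := conjTranspose_mul_self_eq_zero.1 (hM.isUnit.mul_left_eq_zero.1 hprod)
  rw [Matrix.mul_assoc, hBK, Matrix.mul_zero]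

end RealMatrix

section Tuple

/-- Tuples of real square matrices, one for each mode in `ι`, with the entrywise Loewner order. -/
abbrev Tuple (ι κ : Type*) : Type _ := ι → Matrix κ κ ℝ

variable {ι κ : Type*}

lemma exists_tendsto_of_antitone_matrix [Finite κ] {X : ℕ → Matrix κ κ ℝ} (hX : Antitone X)
    (hnonneg : ∀ k, 0 ≤ X k) : ∃ Y, Tendsto X atTop (𝓝 Y) := by
  have := Fintype.ofFinite κ
  have hconv (f : Matrix κ κ ℝ →ₗ[ℝ] ℝ) (hf : ∀ Z, 0 ≤ Z → 0 ≤ f Z) :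
      ∃ y, Tendsto (fun k => f (X k)) atTop (𝓝 y) := by
    refine ⟨_, tendsto_atTop_ciInf (fun k l hkl => ?_) ⟨0, ?_⟩⟩
    · exact sub_nonneg.1 ((hf _ (sub_nonneg.2 (hX hkl))).trans_eq (map_sub f _ _))
    · rintro _ ⟨k, rfl⟩
      exact hf _ (hnonneg k)
  obtain ⟨t, ht⟩ := hconv (traceLinearMap κ ℝ ℝ) fun Z hZ => hZ.posSemidef.trace_nonneg
  -- An entry is not monotone in the Loewner order, but its sum with the trace is.
  have hentry (a b : κ) : ∃ y, Tendsto (fun k => X k a b) atTop (𝓝 y) := by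
    obtain ⟨y, hy⟩ := hconv (traceLinearMap κ ℝ ℝ + entryLinearMap ℝ ℝ a b) fun Z hZ =>
      neg_le_iff_add_nonneg'.1 (abs_le.1 (abs_apply_le_trace hZ.posSemidef a b)).1
    exact ⟨y - t, by simpa using hy.sub ht⟩
  choose Y hY using hentry
  exact ⟨of Y, tendsto_pi_nhds.2 fun a => tendsto_pi_nhds.2 (hY a)⟩

lemma exists_tendsto_of_antitone [Finite κ] {V : ℕ → Tuple ι κ} (hV : Antitone V)
    (hnonneg : ∀ k, 0 ≤ V k) : ∃ W, Tendsto V atTop (𝓝 W) := by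
  choose W hW using fun i => exists_tendsto_of_antitone_matrix (X := fun k => V k i)
    (fun _ _ hkl => hV hkl i) fun k => hnonneg k i
  exact ⟨W, tendsto_pi_nhds.2 hW⟩

lemma tendsto_zero_of_nonneg_of_le [Finite κ] {V W : ℕ → Tuple ι κ} (hV : ∀ k, 0 ≤ V k)
    (hVW : ∀ k, V k ≤ W k) (hW : Tendsto W atTop (𝓝 0)) : Tendsto V atTop (𝓝 0) := by
  have := Fintype.ofFinite κ
  refine tendsto_pi_nhds.2 fun i => tendsto_pi_nhds.2 fun a => tendsto_pi_nhds.2 fun b => ?_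
  have htrace : Continuous fun X : Tuple ι κ => (X i).trace := by fun_prop
  refine squeeze_zero_norm (fun k => ?_) (by simpa using (htrace.tendsto 0).comp hW)
  calc ‖V k i a b‖ ≤ (V k i).trace := abs_apply_le_trace (hV k i).posSemidef a b
    _ ≤ (W k i).trace := by
      simpa only [trace_sub, sub_nonneg] using (sub_nonneg.2 (hVW k i)).posSemidef.trace_nonneg

variable [Fintype ι] [Fintype κ]

/-- The sum of the traces of the entries of a tuple; `totalTrace (U * V)` is the trace inner product
of tuples of symmetric matrices. -/
def totalTrace : Tuple ι κ →ₗ[ℝ] ℝ := ∑ i, traceLinearMap κ ℝ ℝ ∘ₗ LinearMap.proj i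

lemma totalTrace_apply (V : Tuple ι κ) : totalTrace V = ∑ i, (V i).trace := by
  simp [totalTrace]

lemma continuous_totalTrace : Continuous (totalTrace : Tuple ι κ → ℝ) :=
  totalTrace.continuous_of_finiteDimensional

lemma abs_apply_le_totalTrace {V : Tuple ι κ} (hV : 0 ≤ V) (i : ι) (a b : κ) :
    |V i a b| ≤ totalTrace V := by
  rw [totalTrace_apply]
  exact (abs_apply_le_trace (hV i).posSemidef a b).trans
    (Finset.single_le_sum (f := fun i => (V i).trace)
      (fun j _ => (hV j).posSemidef.trace_nonneg) (Finset.mem_univ i))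

lemma totalTrace_nonneg {V : Tuple ι κ} (hV : 0 ≤ V) : 0 ≤ totalTrace V := by
  rw [totalTrace_apply]
  exact Finset.sum_nonneg fun i _ => (hV i).posSemidef.trace_nonneg

lemma isCompact_setOf_nonneg_totalTrace_le (c : ℝ) :
    IsCompact {V : Tuple ι κ | 0 ≤ V ∧ totalTrace V ≤ c} := by
  have hbox : IsCompact {V : ι → κ → κ → ℝ | ∀ i a b, V i a b ∈ Set.Icc (-c) c} :=
    isCompact_pi_infinite fun _ => isCompact_pi_infinite fun _ =>
      isCompact_pi_infinite fun _ => isCompact_Icc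
  refine hbox.of_isClosed_subset ?_ fun V hV i a b =>
    abs_le.1 ((abs_apply_le_totalTrace hV.1 i a b).trans hV.2)
  exact (isClosed_le continuous_const continuous_id).inter
    (isClosed_le continuous_totalTrace continuous_const)

end Tuple

section PositiveOperator

variable {ι κ : Type*}

/-- The tuple of block matrices `[W V; Vᵀ W]`, positive semidefinite when `W` dominates `V`. -/
def blockTuple (W V : Tuple ι κ) : Tuple ι (κ ⊕ κ) :=
  fun i => fromBlocks (W i) (V i) (V i)ᵀ (W i)

/-- `2`-positivity of an operator on tuples, in the form needed to control its values on arbitrary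
tuples by those on nonnegative ones. -/
def IsTwoPositive (T : Tuple ι κ →ₗ[ℝ] Tuple ι κ) : Prop :=
  ∀ ⦃W V⦄, 0 ≤ blockTuple W V → 0 ≤ blockTuple (T W) (T V)

lemma IsTwoPositive.comp {S T : Tuple ι κ →ₗ[ℝ] Tuple ι κ} (hS : IsTwoPositive S)
    (hT : IsTwoPositive T) : IsTwoPositive (S ∘ₗ T) :=
  fun _ _ h => hS (hT h)

lemma IsTwoPositive.pow {T : Tuple ι κ →ₗ[ℝ] Tuple ι κ} (hT : IsTwoPositive T) (k : ℕ) :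
    IsTwoPositive (T ^ k) := by
  induction k with
  | zero => exact fun _ _ h => h
  | succ k ih => exact ih.comp hT

lemma nonneg_of_blockTuple_nonneg {W V : Tuple ι κ} (h : 0 ≤ blockTuple W V) : 0 ≤ W :=
  fun i => ((h i).posSemidef.submatrix Sum.inl).nonneg

lemma abs_apply_le_of_blockTuple_nonneg [Fintype κ] {W V : Tuple ι κ} (h : 0 ≤ blockTuple W V)
    (i : ι) (a b : κ) : |V i a b| ≤ 2 * (W i).trace := by
  calc |V i a b| ≤ (blockTuple W V i).trace :=
      abs_apply_le_trace (h i).posSemidef (Sum.inl a) (Sum.inr b)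
    _ = 2 * (W i).trace := by simp [blockTuple, trace, two_mul]

variable [Finite κ]

lemma exists_blockTuple_smul_one_nonneg [Finite ι] [DecidableEq κ] (V : Tuple ι κ) :
    ∃ c : ℝ, 0 ≤ blockTuple (c • 1) V := by
  have hherm (i : ι) : (fromBlocks 0 (V i) (V i)ᵀ 0).IsHermitian := by
    simp [IsHermitian, fromBlocks_transpose]
  have hblock (c : ℝ) (i : ι) :
      blockTuple (c • 1) V i = c • 1 + fromBlocks 0 (V i) (V i)ᵀ 0 := by
    rw [← fromBlocks_one, fromBlocks_smul, fromBlocks_add]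
    simp [blockTuple]
  obtain ⟨c, hc⟩ := (eventually_all.2 fun i => eventually_smul_one_add_nonneg (hherm i)).exists
  exact ⟨c, fun i => (hc i).trans_eq (hblock c i).symm⟩

lemma blockTuple_zero_nonneg {W : Tuple ι κ} (hW : 0 ≤ W) : 0 ≤ blockTuple W 0 := fun i => by
  have := Fintype.ofFinite κ
  obtain ⟨B, hB⟩ := exists_eq_transpose_mul_self (hW i).posSemidef
  have hsq : blockTuple W 0 i = (fromBlocks B 0 0 B)ᴴ * fromBlocks B 0 0 B := by
    simp [blockTuple, fromBlocks_transpose, fromBlocks_multiply, hB]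
  exact hsq ▸ (posSemidef_conjTranspose_mul_self _).nonneg

lemma IsTwoPositive.map_nonneg {T : Tuple ι κ →ₗ[ℝ] Tuple ι κ} (hT : IsTwoPositive T)
    {W : Tuple ι κ} (hW : 0 ≤ W) : 0 ≤ T W :=
  nonneg_of_blockTuple_nonneg (hT (blockTuple_zero_nonneg hW))

lemma IsTwoPositive.monotone {T : Tuple ι κ →ₗ[ℝ] Tuple ι κ} (hT : IsTwoPositive T) :
    Monotone T := fun V W h =>
  sub_nonneg.1 ((hT.map_nonneg (sub_nonneg.2 h)).trans_eq (map_sub T W V))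

lemma IsTwoPositive.isSchurStable_of_tendsto_pow_one [Finite ι] [DecidableEq κ]
    {T : Tuple ι κ →ₗ[ℝ] Tuple ι κ} (hT : IsTwoPositive T)
    (h : Tendsto (fun k : ℕ => (T ^ k) 1) atTop (𝓝 0)) : IsSchurStable T := fun V => by
  have := Fintype.ofFinite κ
  obtain ⟨c, hc⟩ := exists_blockTuple_smul_one_nonneg V
  refine tendsto_pi_nhds.2 fun i => tendsto_pi_nhds.2 fun a => tendsto_pi_nhds.2 fun b => ?_
  have htrace : Continuous fun W : Tuple ι κ => 2 * (c • W i).trace := by fun_prop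
  refine squeeze_zero_norm (fun k => ?_) (by simpa using (htrace.tendsto 0).comp h)
  simpa using abs_apply_le_of_blockTuple_nonneg (hT.pow k hc) i a b

theorem IsTwoPositive.isSchurStable_of_smul_one_add_map_le [Finite ι] [DecidableEq κ]
    {T : Tuple ι κ →ₗ[ℝ] Tuple ι κ} (hT : IsTwoPositive T) {c : ℝ} (hc : 0 < c) {W : Tuple ι κ}
    (hW : 0 ≤ W) (h : c • 1 + T W ≤ W) : IsSchurStable T := by
  have := Fintype.ofFinite κ
  have hstep (k : ℕ) : c • (T ^ k) 1 ≤ (T ^ k) W - (T ^ (k + 1)) W := by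
    have := (hT.pow k).monotone h
    rwa [map_add, map_smul, ← Module.End.mul_apply, ← pow_succ, ← le_sub_iff_add_le] at this
  have hone (k : ℕ) : 0 ≤ c • (T ^ k) 1 :=
    smul_nonneg hc.le ((hT.pow k).map_nonneg fun _ => zero_le_one)
  have hanti : Antitone fun k => (T ^ k) W :=
    antitone_nat_of_succ_le fun k => sub_nonneg.1 ((hone k).trans (hstep k))
  obtain ⟨X, hX⟩ := exists_tendsto_of_antitone hanti fun k => (hT.pow k).map_nonneg hW
  have hdiff : Tendsto (fun k => c⁻¹ • ((T ^ k) W - (T ^ (k + 1)) W)) atTop (𝓝 0) := by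
    simpa using (hX.sub (hX.comp (tendsto_add_atTop_nat 1))).const_smul c⁻¹
  refine hT.isSchurStable_of_tendsto_pow_one (tendsto_zero_of_nonneg_of_le
    (fun k => (hT.pow k).map_nonneg fun _ => zero_le_one) (fun k => ?_) hdiff)
  exact (le_inv_smul_iff_of_pos hc).2 (hstep k)

end PositiveOperator

section LimitOfStable

variable {ι κ α : Type*} [Finite ι] [Finite κ] [TopologicalSpace α]

-- The normalized Lyapunov solutions `X k = (1 + tr (U k))⁻¹ • U k` satisfy
-- `X k = T (a k) (X k) + (1 - tr (X k)) • 1`, an equation that passes to a limit point.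
theorem isSchurStable_or_exists_fixed_of_tendsto {T : α → Tuple ι κ →ₗ[ℝ] Tuple ι κ}
    (hcont : Continuous fun q : α × Tuple ι κ => T q.1 q.2) (hpos : ∀ x, IsTwoPositive (T x))
    {a : ℕ → α} {b : α} (ha : Tendsto a atTop (𝓝 b)) (hstable : ∀ k, IsSchurStable (T (a k))) :
    IsSchurStable (T b) ∨ ∃ U, 0 ≤ U ∧ U ≠ 0 ∧ T b U = U := by
  classical
  have := Fintype.ofFinite ι
  have := Fintype.ofFinite κ
  have hsol (k : ℕ) : ∃ X : Tuple ι κ, (0 ≤ X ∧ totalTrace X ≤ 1) ∧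
      T (a k) X + (1 - totalTrace X) • 1 = X := by
    let U := lyapunovSolution (T (a k)) 1
    have hU : 0 ≤ U := (hstable k).lyapunovSolution_nonneg (hpos _).monotone fun _ => zero_le_one
    have htr : 0 < 1 + totalTrace U := add_pos_of_pos_of_nonneg one_pos (totalTrace_nonneg hU)
    have hnorm : 1 - totalTrace ((1 + totalTrace U)⁻¹ • U) = (1 + totalTrace U)⁻¹ := by
      rw [map_smul, smul_eq_mul]
      field_simp
      ring
    refine ⟨(1 + totalTrace U)⁻¹ • U, ⟨smul_nonneg (inv_nonneg.2 htr.le) hU, ?_⟩, ?_⟩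
    · exact sub_nonneg.1 ((inv_nonneg.2 htr.le).trans_eq hnorm.symm)
    · rw [hnorm, map_smul, ← smul_add, (hstable k).map_lyapunovSolution_add]
  choose X hX hfix using hsol
  have : FirstCountableTopology (Tuple ι κ) :=
    inferInstanceAs (FirstCountableTopology (ι → κ → κ → ℝ))
  obtain ⟨Y, hY, φ, hφ, hlim⟩ := (isCompact_setOf_nonneg_totalTrace_le 1).tendsto_subseq hX
  have hfixY : T b Y + (1 - totalTrace Y) • 1 = Y := by
    have hleft : Continuous fun q : α × Tuple ι κ => T q.1 q.2 + (1 - totalTrace q.2) • 1 :=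
      hcont.add ((continuous_const.sub (continuous_totalTrace.comp continuous_snd)).smul
        continuous_const)
    refine tendsto_nhds_unique
      ((hleft.tendsto (b, Y)).comp ((ha.comp hφ.tendsto_atTop).prodMk_nhds hlim)) ?_
    exact hlim.congr fun k => (hfix (φ k)).symm
  rcases hY.2.lt_or_eq with hlt | heq
  · exact .inl ((hpos b).isSchurStable_of_smul_one_add_map_le (sub_pos.2 hlt) hY.1
      ((add_comm _ _).trans hfixY).le)
  · refine .inr ⟨Y, hY.1, ?_, by simpa [heq] using hfixY⟩
    rintro rfl
    simp at heq

end LimitOfStable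

section Adjoint

variable {ι κ : Type*} [Fintype ι] [Fintype κ]

/-- `S` is the adjoint of `T` for the bilinear form `totalTrace (U * V)`. -/
def IsTraceAdjoint (T S : Tuple ι κ →ₗ[ℝ] Tuple ι κ) : Prop :=
  ∀ U V, totalTrace (U * T V) = totalTrace (S U * V)

lemma IsTraceAdjoint.comp {T S T' S' : Tuple ι κ →ₗ[ℝ] Tuple ι κ} (h : IsTraceAdjoint T S)
    (h' : IsTraceAdjoint T' S') : IsTraceAdjoint (T ∘ₗ T') (S' ∘ₗ S) := fun U V => by
  rw [LinearMap.comp_apply, h, h', LinearMap.comp_apply]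

lemma IsTraceAdjoint.pow {T S : Tuple ι κ →ₗ[ℝ] Tuple ι κ} (h : IsTraceAdjoint T S) (k : ℕ) :
    IsTraceAdjoint (T ^ k) (S ^ k) := by
  induction k with
  | zero => exact fun _ _ => rfl
  | succ k ih =>
    rw [pow_succ, pow_succ']
    exact ih.comp h

lemma IsTraceAdjoint.symm {T S : Tuple ι κ →ₗ[ℝ] Tuple ι κ} (h : IsTraceAdjoint T S) :
    IsTraceAdjoint S T := fun U V => by
  have hcomm (X Y : Tuple ι κ) : totalTrace (X * Y) = totalTrace (Y * X) := by
    simp only [totalTrace_apply, Pi.mul_apply]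
    exact Finset.sum_congr rfl fun i _ => trace_mul_comm _ _
  rw [hcomm, ← h, hcomm]

lemma totalTrace_single_mul [DecidableEq ι] [DecidableEq κ] (V : Tuple ι κ) (i : ι) (a b : κ) :
    totalTrace (Pi.single i (single b a 1) * V) = V i a b := by
  rw [totalTrace_apply, Finset.sum_eq_single i] <;> simp +contextual [trace_single_mul]

lemma IsTraceAdjoint.isSchurStable {T S : Tuple ι κ →ₗ[ℝ] Tuple ι κ} (h : IsTraceAdjoint T S)
    (hS : IsSchurStable S) : IsSchurStable T := fun V => by
  classical
  refine tendsto_pi_nhds.2 fun i => tendsto_pi_nhds.2 fun a => tendsto_pi_nhds.2 fun b => ?_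
  have hcont : Continuous fun U : Tuple ι κ => totalTrace (U * V) :=
    continuous_totalTrace.comp (continuous_id.mul continuous_const)
  have hlim := (hcont.tendsto 0).comp (hS (Pi.single i (single b a 1)))
  simp only [zero_mul, map_zero] at hlim
  refine hlim.congr fun k => ?_
  rw [Function.comp_apply, ← h.pow k, totalTrace_single_mul]

end Adjoint

section JumpOperator

variable {ι κ : Type*}

/-- The tuple `V` averaged with the weights in each column of `P`. -/
def average [Fintype ι] (P : Matrix ι ι ℝ) : Tuple ι κ →ₗ[ℝ] Tuple ι κ where
  toFun V j := ∑ i, P i j • V i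
  map_add' V W := by
    funext j
    simp [Finset.sum_add_distrib]
  map_smul' c V := by
    funext j
    simp [Finset.smul_sum, smul_comm c]

/-- The entrywise congruence transformation of a tuple by `F`. -/
def congruence [Fintype κ] (F : Tuple ι κ) : Tuple ι κ →ₗ[ℝ] Tuple ι κ where
  toFun V i := F i * V i * (F i)ᵀ
  map_add' V W := by
    funext i
    simp [mul_add, add_mul]
  map_smul' c V := by
    funext i
    simp

lemma average_apply [Fintype ι] (P : Matrix ι ι ℝ) (V : Tuple ι κ) (j : ι) :
    average P V j = ∑ i, P i j • V i := rfl

lemma congruence_apply [Fintype κ] (F V : Tuple ι κ) (i : ι) :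
    congruence F V i = F i * V i * (F i)ᵀ := rfl

lemma average_nonneg [Fintype ι] [Finite κ] {P : Matrix ι ι ℝ} (hP : ∀ i j, 0 ≤ P i j)
    {V : Tuple ι κ} (hV : 0 ≤ V) : 0 ≤ average P V := fun j => by
  have := Fintype.ofFinite κ
  exact Finset.sum_nonneg fun i _ => smul_nonneg (hP i j) (hV i)

lemma congruence_nonneg [Fintype κ] (F : Tuple ι κ) {V : Tuple ι κ} (hV : 0 ≤ V) :
    0 ≤ congruence F V :=
  fun i => (posSemidef_mul_mul_transpose (hV i).posSemidef (F i)).nonneg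

lemma isTwoPositive_average [Fintype ι] [Finite κ] {P : Matrix ι ι ℝ} (hP : ∀ i j, 0 ≤ P i j) :
    IsTwoPositive (average P : Tuple ι κ →ₗ[ℝ] Tuple ι κ) := fun W V h => by
  have hblock : blockTuple (average P W) (average P V) = average P (blockTuple W V) := by
    funext j
    ext (a | a) (b | b) <;> simp [blockTuple, average_apply, Matrix.sum_apply]
  exact hblock ▸ average_nonneg hP h

lemma isTwoPositive_congruence [Fintype κ] (F : Tuple ι κ) :
    IsTwoPositive (congruence F) := fun W V h => by
  have hblock : blockTuple (congruence F W) (congruence F V)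
      = congruence (blockTuple F 0) (blockTuple W V) := by
    funext i
    simp [blockTuple, congruence_apply, fromBlocks_transpose, fromBlocks_multiply, mul_assoc]
  exact hblock ▸ congruence_nonneg _ h

lemma isTraceAdjoint_average [Fintype ι] [Fintype κ] (P : Matrix ι ι ℝ) :
    IsTraceAdjoint (average P : Tuple ι κ →ₗ[ℝ] Tuple ι κ) (average Pᵀ) := fun U V => by
  simp only [totalTrace_apply, Pi.mul_apply, average_apply, Finset.mul_sum, Finset.sum_mul,
    trace_sum, mul_smul_comm, smul_mul_assoc, trace_smul, transpose_apply]
  exact Finset.sum_comm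

lemma isTraceAdjoint_congruence [Fintype ι] [Fintype κ] (F : Tuple ι κ) :
    IsTraceAdjoint (congruence F) (congruence fun i => (F i)ᵀ) := fun U V => by
  simp only [totalTrace_apply, Pi.mul_apply, congruence_apply, transpose_transpose]
  refine Finset.sum_congr rfl fun i _ => ?_
  rw [← mul_assoc, trace_mul_comm]
  simp only [mul_assoc]

/-- The adjoint `U ↦ ((F i)ᵀ * (∑ j, P i j • U j) * F i)_i` of the jump operator. -/
def jumpAdjoint [Fintype ι] [Fintype κ] (P : Matrix ι ι ℝ) (F : Tuple ι κ) :
    Tuple ι κ →ₗ[ℝ] Tuple ι κ :=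
  congruence (fun i => (F i)ᵀ) ∘ₗ average Pᵀ

lemma jumpAdjoint_apply [Fintype ι] [Fintype κ] (P : Matrix ι ι ℝ) (F U : Tuple ι κ) (i : ι) :
    jumpAdjoint P F U i = (F i)ᵀ * (∑ j, P i j • U j) * F i := rfl

variable [Fintype ι]

lemma continuous_jumpAdjoint [Fintype κ] (P : Matrix ι ι ℝ) :
    Continuous fun q : Tuple ι κ × Tuple ι κ => jumpAdjoint P q.1 q.2 := by
  simp only [continuous_pi_iff, jumpAdjoint_apply]
  fun_prop

lemma isTwoPositive_jumpAdjoint [Fintype κ] {P : Matrix ι ι ℝ} (hP : ∀ i j, 0 ≤ P i j)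
    (F : Tuple ι κ) : IsTwoPositive (jumpAdjoint P F) :=
  (isTwoPositive_congruence _).comp (isTwoPositive_average fun i j => hP j i)

variable {n : ℕ}

lemma jumpOperator_eq_comp (P : Matrix ι ι ℝ) (F : Tuple ι (Fin n)) :
    jumpOperator P F = average P ∘ₗ congruence F := rfl

lemma isTwoPositive_jumpOperator {P : Matrix ι ι ℝ} (hP : ∀ i j, 0 ≤ P i j)
    (F : Tuple ι (Fin n)) : IsTwoPositive (jumpOperator P F) :=
  jumpOperator_eq_comp P F ▸ (isTwoPositive_average hP).comp (isTwoPositive_congruence F)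

lemma isTraceAdjoint_jumpOperator (P : Matrix ι ι ℝ) (F : Tuple ι (Fin n)) :
    IsTraceAdjoint (jumpOperator P F) (jumpAdjoint P F) :=
  jumpOperator_eq_comp P F ▸ (isTraceAdjoint_average P).comp (isTraceAdjoint_congruence F)

theorem isSchurStable_jumpOperator_or_exists_fixed_of_tendsto {P : Matrix ι ι ℝ}
    (hP : ∀ i j, 0 ≤ P i j) {F : ℕ → Tuple ι (Fin n)} {G : Tuple ι (Fin n)}
    (hF : Tendsto F atTop (𝓝 G)) (hstable : ∀ k, IsSchurStable (jumpOperator P (F k))) :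
    IsSchurStable (jumpOperator P G) ∨ ∃ U, 0 ≤ U ∧ U ≠ 0 ∧ jumpAdjoint P G U = U :=
  (isSchurStable_or_exists_fixed_of_tendsto (continuous_jumpAdjoint P)
    (isTwoPositive_jumpAdjoint hP) hF
    fun k => (isTraceAdjoint_jumpOperator P (F k)).symm.isSchurStable (hstable k)).imp_left
    (isTraceAdjoint_jumpOperator P G).isSchurStable

end JumpOperator

section Riccati

lemma eventually_smul_one_le_of_posDef {κ : Type*} [Finite κ] [DecidableEq κ]
    {X : Matrix κ κ ℝ} (hX : X.PosDef) : ∀ᶠ c : ℝ in 𝓝[>] 0, c • 1 ≤ X := by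
  have := Fintype.ofFinite κ
  have hspec : ∀ᶠ c : ℝ in 𝓝[>] 0, ∀ x ∈ spectrum ℝ X, c ≤ x :=
    X.finite_real_spectrum.eventually_all.2 fun x hx =>
      eventually_nhdsWithin_of_eventually_nhds
        (eventually_le_nhds (hX.isStrictlyPositive.spectrum_pos hx))
  filter_upwards [hspec] with c hc
  rw [← Algebra.algebraMap_eq_smul_one]
  exact algebraMap_le_of_le_spectrum (fun x hx => hc x hx) hX.isHermitian

lemma exists_smul_one_le_of_posDef {ι κ : Type*} [Finite ι] [Finite κ] [DecidableEq κ]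
    {V : Tuple ι κ} (hV : ∀ i, (V i).PosDef) : ∃ c : ℝ, 0 < c ∧ c • 1 ≤ V := by
  have hle : ∀ᶠ c : ℝ in 𝓝[>] 0, c • 1 ≤ V :=
    eventually_all.2 fun i => eventually_smul_one_le_of_posDef (hV i)
  exact (eventually_mem_nhdsWithin.and hle).exists

lemma average_smul_const {ι κ : Type*} [Fintype ι] {P : Matrix ι ι ℝ} {μ : ι → ℝ}
    (hst : μ ᵥ* P = μ) (S : Matrix κ κ ℝ) :
    average P (fun i => μ i • S) = fun i => μ i • S := by
  funext j
  simp only [average_apply, smul_smul, ← Finset.sum_smul]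
  congr 1
  conv_rhs => rw [← hst]
  simp only [vecMul, dotProduct, mul_comm]

lemma mul_mul_transpose_add_eq_add_sq {κ ν : Type*} [Fintype κ] [Fintype ν] {A Y : Matrix κ κ ℝ}
    {H : Matrix ν κ ℝ} {S : Matrix ν ν ℝ} {K : Matrix κ ν ℝ} (hY : Y.IsHermitian)
    (hS : S.IsHermitian) (hK : K * (H * Y * Hᵀ + S) = A * Y * Hᵀ) (L : Matrix κ ν ℝ) :
    (A + L * H) * Y * (A + L * H)ᵀ + L * S * Lᵀ
      = A * Y * Aᵀ - K * (H * Y * Aᵀ) + (L + K) * (H * Y * Hᵀ + S) * (L + K)ᵀ := by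
  have hKt : (H * Y * Hᵀ + S) * Kᵀ = H * Y * Aᵀ := by
    have hYt : Yᵀ = Y := by simpa using hY.eq
    have hSt : Sᵀ = S := by simpa using hS.eq
    simpa [hYt, hSt, Matrix.mul_assoc] using congrArg transpose hK
  have hexpand (M : Matrix ν ν ℝ) : (L + K) * M * (L + K)ᵀ
      = L * M * Lᵀ + L * (M * Kᵀ) + K * M * Lᵀ + K * (M * Kᵀ) := by
    simp only [transpose_add, Matrix.add_mul, Matrix.mul_add, Matrix.mul_assoc]
    abel
  rw [hexpand, hKt, hK]
  simp only [transpose_add, transpose_mul, Matrix.add_mul, Matrix.mul_add, Matrix.mul_assoc]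
  abel

variable {ι : Type*} {m n : ℕ} {A Q Q' : Matrix (Fin n) (Fin n) ℝ}
  {H : ι → Matrix (Fin m) (Fin n) ℝ} {R : Matrix (Fin m) (Fin m) ℝ} {P : Matrix ι ι ℝ} {μ : ι → ℝ}
  {L : ι → Matrix (Fin n) (Fin m) ℝ} {Y Y' : Tuple ι (Fin n)}

/-- The error matrices `A + L i * H i` of the filter with gains `L`. -/
def closedLoop (A : Matrix (Fin n) (Fin n) ℝ) (H : ι → Matrix (Fin m) (Fin n) ℝ)
    (L : ι → Matrix (Fin n) (Fin m) ℝ) : Tuple ι (Fin n) :=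
  fun i => A + L i * H i

/-- The covariances contributed in one step by the process noise `Q` and the measurement noise
`R`. -/
def noise (Q : Matrix (Fin n) (Fin n) ℝ) (R : Matrix (Fin m) (Fin m) ℝ) (μ : ι → ℝ)
    (L : ι → Matrix (Fin n) (Fin m) ℝ) : Tuple ι (Fin n) :=
  fun i => μ i • (L i * R * (L i)ᵀ + Q)

/-- The innovation covariances `H i * Y i * (H i)ᵀ + μ i • R`. -/
def innovation (H : ι → Matrix (Fin m) (Fin n) ℝ) (R : Matrix (Fin m) (Fin m) ℝ) (μ : ι → ℝ)
    (Y : Tuple ι (Fin n)) : Tuple ι (Fin m) :=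
  fun i => H i * Y i * (H i)ᵀ + μ i • R

/-- The excess of the error covariances after one step with the gains `L` over those with the
Kalman gains. -/
def excess (A : Matrix (Fin n) (Fin n) ℝ) (H : ι → Matrix (Fin m) (Fin n) ℝ)
    (R : Matrix (Fin m) (Fin m) ℝ) (μ : ι → ℝ) (L : ι → Matrix (Fin n) (Fin m) ℝ)
    (Y : Tuple ι (Fin n)) : Tuple ι (Fin n) :=
  fun i => (L i + gain A H R μ Y i) * innovation H R μ Y i * (L i + gain A H R μ Y i)ᵀ

/-- The error covariances after one step with the gains `L`, before averaging over the transitions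
of the chain. -/
def covUpdate (A : Matrix (Fin n) (Fin n) ℝ) (H : ι → Matrix (Fin m) (Fin n) ℝ)
    (Q : Matrix (Fin n) (Fin n) ℝ) (R : Matrix (Fin m) (Fin m) ℝ) (μ : ι → ℝ)
    (L : ι → Matrix (Fin n) (Fin m) ℝ) (Y : Tuple ι (Fin n)) : Tuple ι (Fin n) :=
  congruence (closedLoop A H L) Y + noise Q R μ L

lemma noise_le_noise (hμ : ∀ i, 0 ≤ μ i) (hQ : Q' ≤ Q) : noise Q' R μ L ≤ noise Q R μ L :=
  fun i => smul_le_smul_of_nonneg_left (add_le_add_right hQ _) (hμ i)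

lemma smul_le_noise (hR : R.PosSemidef) (hμ : ∀ i, 0 ≤ μ i) :
    (fun i => μ i • Q) ≤ noise Q R μ L := fun i =>
  smul_le_smul_of_nonneg_left
    (le_add_of_nonneg_left (posSemidef_mul_mul_transpose hR (L i)).nonneg) (hμ i)

lemma noise_nonneg (hQ : 0 ≤ Q) (hR : R.PosSemidef) (hμ : ∀ i, 0 ≤ μ i) :
    0 ≤ noise Q R μ L :=
  le_trans (fun i => smul_nonneg (hμ i) hQ) (smul_le_noise hR hμ)

lemma posDef_innovation (hR : R.PosDef) (hμ : ∀ i, 0 < μ i) (hY : 0 ≤ Y) (i : ι) :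
    (innovation H R μ Y i).PosDef :=
  (hR.smul (hμ i)).posSemidef_add (posSemidef_mul_mul_transpose (hY i).posSemidef (H i))

lemma gain_mul_innovation (hR : R.PosDef) (hμ : ∀ i, 0 < μ i) (hY : 0 ≤ Y) (i : ι) :
    gain A H R μ Y i * innovation H R μ Y i = A * Y i * (H i)ᵀ :=
  nonsing_inv_mul_cancel_right _ _
    ((isUnit_iff_isUnit_det _).1 (posDef_innovation hR hμ hY i).isUnit)

lemma excess_nonneg (hR : R.PosDef) (hμ : ∀ i, 0 < μ i) (hY : 0 ≤ Y) :
    0 ≤ excess A H R μ L Y := fun i =>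
  (posSemidef_mul_mul_transpose (posDef_innovation hR hμ hY i).posSemidef _).nonneg

lemma covUpdate_apply_eq (hR : R.PosDef) (hμ : ∀ i, 0 < μ i) (hY : 0 ≤ Y) (i : ι) :
    covUpdate A H Q R μ L Y i
      = A * Y i * Aᵀ - gain A H R μ Y i * (H i * Y i * Aᵀ) + μ i • Q + excess A H R μ L Y i := by
  have hsq : _ = _ + excess A H R μ L Y i :=
    mul_mul_transpose_add_eq_add_sq (hY i).posSemidef.isHermitian
      (hR.smul (hμ i)).isHermitian (gain_mul_innovation hR hμ hY i) (L i)
  rw [Matrix.mul_smul, Matrix.smul_mul] at hsq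
  rw [add_right_comm, ← hsq, add_assoc, ← smul_add]
  rfl

lemma covUpdate_eq_add_excess (hR : R.PosDef) (hμ : ∀ i, 0 < μ i) (hY : 0 ≤ Y) :
    covUpdate A H Q R μ L Y
      = covUpdate A H Q R μ (-gain A H R μ Y) Y + excess A H R μ L Y := by
  funext i
  rw [Pi.add_apply, covUpdate_apply_eq hR hμ hY, covUpdate_apply_eq hR hμ hY]
  simp [excess]

lemma solvesCARE_iff [Fintype ι] (hR : R.PosDef) (hμ : ∀ i, 0 < μ i) (hY : 0 ≤ Y) :
    SolvesCARE A H Q R P μ Y ↔ average P (covUpdate A H Q R μ (-gain A H R μ Y) Y) = Y := by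
  rw [SolvesCARE, funext_iff]
  refine forall_congr' fun j => eq_comm.trans (Eq.congr_left (Finset.sum_congr rfl fun i _ => ?_))
  rw [covUpdate_apply_eq hR hμ hY]
  simp [excess, gain]

lemma average_covUpdate [Fintype ι] : average P (covUpdate A H Q R μ L Y)
    = jumpOperator P (closedLoop A H L) Y + average P (noise Q R μ L) :=
  map_add _ _ _

lemma continuousAt_gain (hR : R.PosDef) (hμ : ∀ i, 0 < μ i) (hY : 0 ≤ Y) :
    ContinuousAt (gain A H R μ) Y := by
  refine continuousAt_pi.2 fun i => ?_
  have hinnov : Continuous fun Z : Tuple ι (Fin n) => innovation H R μ Z i := by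
    unfold innovation
    fun_prop
  have hinv : ContinuousAt Inv.inv (innovation H R μ Y i) := by
    refine continuousAt_matrix_inv _ ?_
    simpa only [Ring.inverse_eq_inv']
      using continuousAt_inv₀ (posDef_innovation hR hμ hY i).det_pos.ne'
  have hmul : Continuous fun Z : Matrix (Fin n) (Fin n) ℝ × Matrix (Fin m) (Fin m) ℝ =>
      A * Z.1 * (H i)ᵀ * Z.2 := by fun_prop
  exact hmul.continuousAt.comp (f := fun Z : Tuple ι (Fin n) => (Z i, (innovation H R μ Z i)⁻¹))
    ((continuous_apply i).continuousAt.prodMk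
      (hinv.comp (f := fun Z => innovation H R μ Z i) hinnov.continuousAt))

end Riccati

section PolicyIteration

variable {ι : Type*} [Fintype ι] {m n : ℕ} {A Q Q' : Matrix (Fin n) (Fin n) ℝ}
  {H : ι → Matrix (Fin m) (Fin n) ℝ} {R : Matrix (Fin m) (Fin m) ℝ} {P : Matrix ι ι ℝ} {μ : ι → ℝ}
  {L : ι → Matrix (Fin n) (Fin m) ℝ} {Y Y' : Tuple ι (Fin n)}

lemma isSchurStable_closedLoop_neg_gain (hP : ∀ i j, 0 ≤ P i j) (hμ : ∀ i, 0 < μ i)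
    (hst : μ ᵥ* P = μ) (hQ : Q.PosDef) (hR : R.PosDef) (hY : 0 ≤ Y)
    (hfix : average P (covUpdate A H Q R μ L Y) = Y) :
    IsSchurStable (jumpOperator P (closedLoop A H (-gain A H R μ Y))) := by
  obtain ⟨c, hc, hcQ⟩ := exists_smul_one_le_of_posDef fun i => hQ.smul (hμ i)
  refine (isTwoPositive_jumpOperator hP _).isSchurStable_of_smul_one_add_map_le hc hY ?_
  have hnoise : c • 1 ≤ average P (noise Q R μ (-gain A H R μ Y)) :=
    calc c • 1 ≤ fun i => μ i • Q := hcQ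
      _ = average P fun i => μ i • Q := (average_smul_const hst Q).symm
      _ ≤ _ := (isTwoPositive_average hP).monotone (smul_le_noise hR.posSemidef fun i => (hμ i).le)
  calc c • 1 + jumpOperator P (closedLoop A H (-gain A H R μ Y)) Y
      ≤ average P (covUpdate A H Q R μ (-gain A H R μ Y) Y) := by
        rw [average_covUpdate, add_comm]
        gcongr
    _ ≤ average P (covUpdate A H Q R μ L Y) := by
        refine (isTwoPositive_average hP).monotone ?_
        rw [covUpdate_eq_add_excess hR hμ hY (L := L)]
        exact le_add_of_nonneg_right (excess_nonneg hR hμ hY)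
    _ = Y := hfix

lemma le_of_average_covUpdate_eq (hP : ∀ i j, 0 ≤ P i j) (hμ : ∀ i, 0 < μ i)
    (hQ : Q' ≤ Q) (hR : R.PosDef) (hY : 0 ≤ Y) (hfix : average P (covUpdate A H Q R μ L Y) = Y)
    (hfix' : average P (covUpdate A H Q' R μ (-gain A H R μ Y) Y') = Y')
    (hstable : IsSchurStable (jumpOperator P (closedLoop A H (-gain A H R μ Y)))) : Y' ≤ Y := by
  refine sub_nonneg.1 (hstable.nonneg_of_map_le (isTwoPositive_jumpOperator hP _).monotone ?_)
  have hle : average P (covUpdate A H Q' R μ (-gain A H R μ Y) Y) ≤ Y := by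
    conv_rhs => rw [← hfix, covUpdate_eq_add_excess hR hμ hY]
    refine (isTwoPositive_average hP).monotone (le_add_of_le_of_nonneg ?_ (excess_nonneg hR hμ hY))
    exact add_le_add_right (noise_le_noise (fun i => (hμ i).le) hQ) _
  calc jumpOperator P (closedLoop A H (-gain A H R μ Y)) (Y - Y')
      = average P (covUpdate A H Q' R μ (-gain A H R μ Y) Y)
        - average P (covUpdate A H Q' R μ (-gain A H R μ Y) Y') := by
        rw [average_covUpdate, average_covUpdate, add_sub_add_right_eq_sub, map_sub]
    _ ≤ Y - Y' := by
        rw [hfix']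
        gcongr

/-- The stationary error covariances of the filter with stabilizing gains `L`. -/
def stationaryCov (A : Matrix (Fin n) (Fin n) ℝ) (H : ι → Matrix (Fin m) (Fin n) ℝ)
    (Q : Matrix (Fin n) (Fin n) ℝ) (R : Matrix (Fin m) (Fin m) ℝ) (P : Matrix ι ι ℝ) (μ : ι → ℝ)
    (L : ι → Matrix (Fin n) (Fin m) ℝ) : Tuple ι (Fin n) :=
  lyapunovSolution (jumpOperator P (closedLoop A H L)) (average P (noise Q R μ L))

lemma average_covUpdate_stationaryCov
    (hstable : IsSchurStable (jumpOperator P (closedLoop A H L))) :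
    average P (covUpdate A H Q R μ L (stationaryCov A H Q R P μ L))
      = stationaryCov A H Q R P μ L :=
  average_covUpdate.trans (hstable.map_lyapunovSolution_add _)

lemma stationaryCov_nonneg (hP : ∀ i j, 0 ≤ P i j) (hμ : ∀ i, 0 ≤ μ i) (hQ : 0 ≤ Q)
    (hR : R.PosSemidef) (hstable : IsSchurStable (jumpOperator P (closedLoop A H L))) :
    0 ≤ stationaryCov A H Q R P μ L :=
  hstable.lyapunovSolution_nonneg (isTwoPositive_jumpOperator hP _).monotone
    (average_nonneg hP (noise_nonneg hQ hR hμ))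

/-- Kleinman's policy iteration for the filtering equations: the gains of each step are the Kalman
gains of the stationary error covariances under the previous ones. The process noise `Q k` may vary
from step to step. -/
def policy (A : Matrix (Fin n) (Fin n) ℝ) (H : ι → Matrix (Fin m) (Fin n) ℝ)
    (Q : ℕ → Matrix (Fin n) (Fin n) ℝ) (R : Matrix (Fin m) (Fin m) ℝ) (P : Matrix ι ι ℝ)
    (μ : ι → ℝ) (L : ι → Matrix (Fin n) (Fin m) ℝ) : ℕ → ι → Matrix (Fin n) (Fin m) ℝ
  | 0 => L
  | k + 1 => -gain A H R μ (stationaryCov A H (Q k) R P μ (policy A H Q R P μ L k))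

section Iterates

variable {Q : ℕ → Matrix (Fin n) (Fin n) ℝ}

lemma isSchurStable_policy (hP : ∀ i j, 0 ≤ P i j) (hμ : ∀ i, 0 < μ i) (hst : μ ᵥ* P = μ)
    (hQ : ∀ k, (Q k).PosDef) (hR : R.PosDef)
    (hL : IsSchurStable (jumpOperator P (closedLoop A H L))) (k : ℕ) :
    IsSchurStable (jumpOperator P (closedLoop A H (policy A H Q R P μ L k))) := by
  induction k with
  | zero => exact hL
  | succ k ih =>
    have hcov : 0 ≤ stationaryCov A H (Q k) R P μ (policy A H Q R P μ L k) :=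
      stationaryCov_nonneg hP (fun i => (hμ i).le) (hQ k).posSemidef.nonneg hR.posSemidef ih
    exact isSchurStable_closedLoop_neg_gain hP hμ hst (hQ k) hR hcov
      (average_covUpdate_stationaryCov ih)

lemma antitone_stationaryCov_policy (hP : ∀ i j, 0 ≤ P i j) (hμ : ∀ i, 0 < μ i)
    (hst : μ ᵥ* P = μ) (hQ : ∀ k, (Q k).PosDef) (hanti : Antitone Q) (hR : R.PosDef)
    (hL : IsSchurStable (jumpOperator P (closedLoop A H L))) :
    Antitone fun k => stationaryCov A H (Q k) R P μ (policy A H Q R P μ L k) := by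
  have hstable := isSchurStable_policy hP hμ hst hQ hR hL
  refine antitone_nat_of_succ_le fun k => ?_
  have hcov : 0 ≤ stationaryCov A H (Q k) R P μ (policy A H Q R P μ L k) :=
    stationaryCov_nonneg hP (fun i => (hμ i).le) (hQ k).posSemidef.nonneg hR.posSemidef (hstable k)
  exact le_of_average_covUpdate_eq hP hμ (hanti k.le_succ) hR hcov
    (average_covUpdate_stationaryCov (hstable k))
    (average_covUpdate_stationaryCov (hstable (k + 1))) (hstable (k + 1))

end Iterates

lemma average_covUpdate_eq_of_tendsto {Qseq : ℕ → Matrix (Fin n) (Fin n) ℝ}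
    {K : ℕ → ι → Matrix (Fin n) (Fin m) ℝ} {X : ℕ → Tuple ι (Fin n)}
    (hQ : Tendsto Qseq atTop (𝓝 Q)) (hK : Tendsto K atTop (𝓝 L)) (hX : Tendsto X atTop (𝓝 Y))
    (hfix : ∀ k, average P (covUpdate A H (Qseq k) R μ (K k) (X k)) = X k) :
    average P (covUpdate A H Q R μ L Y) = Y := by
  have hcont : Continuous fun z : Matrix (Fin n) (Fin n) ℝ × (ι → Matrix (Fin n) (Fin m) ℝ) ×
      Tuple ι (Fin n) => average P (covUpdate A H z.1 R μ z.2.1 z.2.2) := by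
    simp only [continuous_pi_iff, average_apply, covUpdate, Pi.add_apply, congruence_apply,
      closedLoop, noise]
    fun_prop
  have hlim := (hcont.tendsto (Q, L, Y)).comp (hQ.prodMk_nhds (hK.prodMk_nhds hX))
  exact tendsto_nhds_unique hlim (hX.congr fun k => (hfix k).symm)

lemma exists_average_covUpdate_eq_of_tendsto (hP : ∀ i j, 0 ≤ P i j) (hμ : ∀ i, 0 < μ i)
    (hst : μ ᵥ* P = μ) {Qseq : ℕ → Matrix (Fin n) (Fin n) ℝ} (hQ : ∀ k, (Qseq k).PosDef)
    (hanti : Antitone Qseq) (hQlim : Tendsto Qseq atTop (𝓝 Q)) (hR : R.PosDef)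
    (hL : IsSchurStable (jumpOperator P (closedLoop A H L))) :
    ∃ Y, 0 ≤ Y ∧ average P (covUpdate A H Q R μ (-gain A H R μ Y) Y) = Y ∧
      Tendsto (fun k => policy A H Qseq R P μ L (k + 1)) atTop (𝓝 (-gain A H R μ Y)) := by
  have hstable := isSchurStable_policy hP hμ hst hQ hR hL
  have hcov (k : ℕ) : 0 ≤ stationaryCov A H (Qseq k) R P μ (policy A H Qseq R P μ L k) :=
    stationaryCov_nonneg hP (fun i => (hμ i).le) (hQ k).posSemidef.nonneg hR.posSemidef (hstable k)
  obtain ⟨Y, hlim⟩ := exists_tendsto_of_antitone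
    (antitone_stationaryCov_policy hP hμ hst hQ hanti hR hL) hcov
  have hY : 0 ≤ Y := ge_of_tendsto' hlim hcov
  have hpolicy : Tendsto (fun k => policy A H Qseq R P μ L (k + 1)) atTop (𝓝 (-gain A H R μ Y)) :=
    ((continuousAt_gain hR hμ hY).tendsto.comp hlim).neg
  have hshift := tendsto_add_atTop_nat 1
  exact ⟨Y, hY, average_covUpdate_eq_of_tendsto (hQlim.comp hshift) hpolicy (hlim.comp hshift)
    fun k => average_covUpdate_stationaryCov (hstable (k + 1)), hpolicy⟩

theorem exists_solvesCARE_of_isSchurStable (hP : ∀ i j, 0 ≤ P i j) (hμ : ∀ i, 0 < μ i)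
    (hst : μ ᵥ* P = μ) (hQ : Q.PosSemidef) (hR : R.PosDef)
    (hL : IsSchurStable (jumpOperator P (closedLoop A H L))) :
    ∃ Y, 0 ≤ Y ∧ SolvesCARE A H Q R P μ Y ∧ ∃ K : ℕ → ι → Matrix (Fin n) (Fin m) ℝ,
      (∀ k, IsSchurStable (jumpOperator P (closedLoop A H (K k)))) ∧
        Tendsto K atTop (𝓝 (-gain A H R μ Y)) := by
  let Qseq (k : ℕ) : Matrix (Fin n) (Fin n) ℝ := Q + (1 / ((k : ℝ) + 1)) • 1
  have hQseq (k : ℕ) : (Qseq k).PosDef :=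
    (PosDef.one.smul Nat.one_div_pos_of_nat).posSemidef_add hQ
  have hanti : Antitone Qseq := fun k l hkl =>
    add_le_add_right (smul_le_smul_of_nonneg_right (Nat.one_div_le_one_div hkl) zero_le_one) Q
  have hQlim : Tendsto Qseq atTop (𝓝 Q) := by
    have hε := (tendsto_one_div_add_atTop_nhds_zero_nat (𝕜 := ℝ)).smul_const
      (1 : Matrix (Fin n) (Fin n) ℝ)
    simpa only [zero_smul, add_zero] using hε.const_add Q
  obtain ⟨Y, hY, hfix, hlim⟩ :=
    exists_average_covUpdate_eq_of_tendsto hP hμ hst hQseq hanti hQlim hR hL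
  exact ⟨Y, hY, (solvesCARE_iff hR hμ hY).2 hfix, _,
    fun k => isSchurStable_policy hP hμ hst hQseq hR hL (k + 1), hlim⟩

end PolicyIteration

section UnitCircle

open scoped ComplexOrder

/-- `A` leaves invariant a nonzero positive semidefinite form that annihilates the range of `Q`;
the dual formulation of an uncontrollable eigenvalue of `(A, Q)` on the unit circle. -/
def HasInvariantForm {R κ ν : Type*} [Ring R] [PartialOrder R] [StarRing R] [Fintype κ]
    (A : Matrix κ κ R) (Q : Matrix κ ν R) : Prop :=
  ∃ S : Matrix κ κ R, S.PosSemidef ∧ S ≠ 0 ∧ Aᴴ * S * A = S ∧ S * Q = 0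

lemma exists_notMem_sub_smul_mem {K V : Type*} [Field K] [IsAlgClosed K] [AddCommGroup V]
    [Module K V] [FiniteDimensional K V] {f : Module.End K V} {W : Submodule K V}
    (hW : W ≤ W.comap f) (hne : W ≠ ⊤) : ∃ (c : K) (x : V), x ∉ W ∧ f x - c • x ∈ W := by
  have : Nontrivial (V ⧸ W) := Submodule.Quotient.nontrivial_iff.2 hne
  obtain ⟨c, hc⟩ := Module.End.exists_eigenvalue (W.mapQ W f hW)
  obtain ⟨w, hw⟩ := hc.exists_hasEigenvector
  obtain ⟨x, rfl⟩ := W.mkQ_surjective w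
  refine ⟨c, x, fun hx => hw.2 ((Submodule.Quotient.mk_eq_zero W).2 hx), ?_⟩
  exact (Submodule.Quotient.eq W).1 hw.apply_eq_smul

lemma posSemidef_map_ofReal {κ : Type*} [Finite κ] {S : Matrix κ κ ℝ} (hS : S.PosSemidef) :
    (S.map Complex.ofReal).PosSemidef := by
  have := Fintype.ofFinite κ
  obtain ⟨B, rfl⟩ := exists_eq_transpose_mul_self hS
  convert posSemidef_conjTranspose_mul_self (B.map Complex.ofReal) using 1
  ext i j
  simp [mul_apply]

lemma posSemidef_map_re {κ : Type*} [Finite κ] {S : Matrix κ κ ℂ} (hS : S.PosSemidef) :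
    (S.map Complex.re).PosSemidef := by
  have := Fintype.ofFinite κ
  refine .of_dotProduct_mulVec_nonneg ?_ fun x => ?_
  · ext i j
    simpa using congrArg Complex.re (hS.isHermitian.apply i j)
  · have hx := (Complex.nonneg_iff.1 (hS.dotProduct_mulVec_nonneg fun i => (x i : ℂ))).1
    simpa [dotProduct, mulVec] using hx

lemma map_re_ne_zero {κ : Type*} [Finite κ] {S : Matrix κ κ ℂ} (hS : S.PosSemidef) (hS0 : S ≠ 0) :
    S.map Complex.re ≠ 0 := fun h => by
  have := Fintype.ofFinite κ
  refine hS0 (hS.trace_eq_zero_iff.1 (Complex.ext ?_ ?_))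
  · simpa [trace] using congrArg trace h
  · exact (Complex.nonneg_iff.1 hS.trace_nonneg).2.symm

variable {κ ν : Type*} [Fintype κ]

lemma exists_mulVec_mul_eq_smul {A S : Matrix κ κ ℂ} (hS : S.PosSemidef) (hS0 : S ≠ 0)
    (hA : Aᴴ * S * A = S) :
    ∃ (z : ℂ) (x : κ → ℂ), ‖z‖ = 1 ∧ S *ᵥ x ≠ 0 ∧ S *ᵥ (A *ᵥ x) = z • S *ᵥ x := by
  classical
  have hform (x : κ → ℂ) : star (A *ᵥ x) ⬝ᵥ S *ᵥ (A *ᵥ x) = star x ⬝ᵥ S *ᵥ x := by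
    conv_rhs => rw [← hA]
    simp only [star_mulVec, ← dotProduct_mulVec, mulVec_mulVec, Matrix.mul_assoc]
  have hker : LinearMap.ker S.mulVecLin ≤ (LinearMap.ker S.mulVecLin).comap A.mulVecLin := by
    intro x hx
    have hx : S *ᵥ x = 0 := hx
    refine (hS.dotProduct_mulVec_zero_iff _).1 ?_
    rw [mulVecLin_apply, hform, hx, dotProduct_zero]
  have hne : LinearMap.ker S.mulVecLin ≠ ⊤ := fun h =>
    hS0 (toLin'.map_eq_zero_iff.1 (LinearMap.ker_eq_top.1 h))
  obtain ⟨z, x, hx, hAx⟩ := exists_notMem_sub_smul_mem hker hne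
  have hx : S *ᵥ x ≠ 0 := hx
  have hAx : S *ᵥ (A *ᵥ x) = z • S *ᵥ x := by
    rwa [LinearMap.mem_ker, map_sub, map_smul, sub_eq_zero] at hAx
  refine ⟨z, x, ?_, hx, hAx⟩
  have hzz : (z * star z) * (star x ⬝ᵥ S *ᵥ x) = 1 * (star x ⬝ᵥ S *ᵥ x) := by
    have hswap (u w : κ → ℂ) : star u ⬝ᵥ S *ᵥ w = star (S *ᵥ u) ⬝ᵥ w := by
      rw [star_mulVec, hS.isHermitian.eq, dotProduct_mulVec]
    conv_rhs => rw [one_mul, ← hform, hAx, dotProduct_smul, hswap, hAx, star_smul, smul_dotProduct,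
      ← hswap, smul_smul, smul_eq_mul]
  have hx0 : star x ⬝ᵥ S *ᵥ x ≠ 0 := fun h => hx ((hS.dotProduct_mulVec_zero_iff x).1 h)
  have hnorm := congrArg norm (mul_right_cancel₀ hx0 hzz)
  rw [norm_mul, norm_star, norm_one] at hnorm
  exact (mul_self_eq_one_iff.1 hnorm).resolve_right (by linarith [norm_nonneg z])

lemma hasInvariantForm_iff_exists_vecMul_eq_smul (A : Matrix κ κ ℂ) (Q : Matrix κ ν ℂ) :
    HasInvariantForm A Q ↔
      ∃ (z : ℂ) (v : κ → ℂ), ‖z‖ = 1 ∧ v ≠ 0 ∧ v ᵥ* A = z • v ∧ v ᵥ* Q = 0 := by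
  constructor
  · rintro ⟨S, hS, hS0, hA, hQ⟩
    obtain ⟨z, x, hz, hx, hAx⟩ := exists_mulVec_mul_eq_smul hS hS0 hA
    have hv : star x ᵥ* S = star (S *ᵥ x) := by rw [star_mulVec, hS.isHermitian.eq]
    have hzz : z * star z = 1 := by simp [Complex.mul_conj, Complex.normSq_eq_norm_sq, hz]
    refine ⟨z, star x ᵥ* S, hz, hv ▸ star_ne_zero.2 hx, ?_, ?_⟩
    · have hAH : Aᴴ *ᵥ (z • S *ᵥ x) = S *ᵥ x := by
        rw [← hAx, mulVec_mulVec, mulVec_mulVec, hA]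
      have hrow : star z • star (S *ᵥ x) ᵥ* A = star (S *ᵥ x) := by
        simpa [star_mulVec, mulVec_smul] using congrArg star hAH
      rw [hv, ← one_smul ℂ (star (S *ᵥ x) ᵥ* A), ← hzz, mul_smul, hrow]
    · rw [vecMul_vecMul, hQ, vecMul_zero]
  · rintro ⟨z, v, hz, hv, hA, hQ⟩
    refine ⟨vecMulVec (star v) v, posSemidef_vecMulVec_star_self v, ?_, ?_, ?_⟩
    · simpa [vecMulVec_eq_zero] using hv
    · have hzz : star z * z = 1 := by simp [Complex.conj_mul', hz]
      rw [mul_vecMulVec, vecMulVec_mul, ← star_vecMul, hA, star_smul, smul_vecMulVec,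
        vecMulVec_smul, smul_smul, hzz, one_smul]
    · ext
      simp [vecMulVec_mul, hQ, vecMulVec_apply]

lemma hasInvariantForm_map_ofReal_iff (A : Matrix κ κ ℝ) (Q : Matrix κ ν ℝ) :
    HasInvariantForm (A.map Complex.ofReal) (Q.map Complex.ofReal) ↔ HasInvariantForm A Q := by
  constructor
  · rintro ⟨S, hS, hS0, hA, hQ⟩
    refine ⟨S.map Complex.re, posSemidef_map_re hS, map_re_ne_zero hS hS0, ?_, ?_⟩
    · conv_rhs => rw [← hA]
      ext i j
      simp [mul_apply]
    · ext i j
      simpa [mul_apply] using congrArg Complex.re (congrFun₂ hQ i j)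
  · rintro ⟨S, hS, hS0, hA, hQ⟩
    refine ⟨S.map Complex.ofReal, posSemidef_map_ofReal hS, ?_, ?_, ?_⟩
    · exact fun h => hS0 (map_injective Complex.ofReal_injective (by simpa using h))
    · conv_rhs => rw [← hA]
      ext i j
      simp [mul_apply]
    · ext i j
      simpa [mul_apply] using congrArg Complex.ofReal (congrFun₂ hQ i j)

lemma rank_eq_card_iff_vecMul_eq_zero {K : Type*} [Field K] [Fintype ν] (M : Matrix κ ν K) :
    M.rank = Fintype.card κ ↔ ∀ v, v ᵥ* M = 0 → v = 0 := by
  have hind : LinearIndependent K M.row ↔ ∀ v, v ᵥ* M = 0 → v = 0 :=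
    vecMul_injective_iff.symm.trans (injective_iff_map_eq_zero M.vecMulLinear)
  rw [← hind, linearIndependent_iff_card_eq_finrank_span, Set.finrank, ← rank_eq_finrank_span_row,
    eq_comm]

lemma rank_fromCols_eq_card_iff_not_hasInvariantForm [Fintype ν] [DecidableEq κ] (A : Matrix κ κ ℝ)
    (Q : Matrix κ ν ℝ) :
    (∀ z : ℂ, ‖z‖ = 1 → (fromCols (z • (1 : Matrix κ κ ℂ) - A.map Complex.ofReal)
      (Q.map Complex.ofReal)).rank = Fintype.card κ) ↔ ¬ HasInvariantForm A Q := by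
  have hleft (z : ℂ) (v : κ → ℂ) : v ᵥ* fromCols (z • 1 - A.map Complex.ofReal)
      (Q.map Complex.ofReal) = 0 ↔ v ᵥ* A.map Complex.ofReal = z • v ∧
        v ᵥ* Q.map Complex.ofReal = 0 := by
    rw [vecMul_fromCols, ← Sum.elim_zero_zero, Sum.elim_eq_iff, vecMul_sub, vecMul_smul, vecMul_one,
      sub_eq_zero, eq_comm (a := z • v)]
  rw [← hasInvariantForm_map_ofReal_iff, hasInvariantForm_iff_exists_vecMul_eq_smul]
  simp only [rank_eq_card_iff_vecMul_eq_zero, hleft]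
  push Not
  exact forall_congr' fun z => ⟨fun h v hz hv hA hQ => hv (h hz v ⟨hA, hQ⟩),
    fun h hz v hv => by_contra fun hv0 => h v hz hv0 hv.1 hv.2⟩

end UnitCircle

section Characterization

lemma transpose_mul_mul_add_mul_of_mul_eq_zero {κ ν : Type*} [Fintype κ] [Fintype ν]
    {S : Matrix κ κ ℝ} {L : Matrix κ ν ℝ} (hS : S.IsHermitian) (hL : S * L = 0)
    (A : Matrix κ κ ℝ) (H : Matrix ν κ ℝ) : (A + L * H)ᵀ * S * (A + L * H) = Aᵀ * S * A := by
  have hright : S * (A + L * H) = S * A := by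
    rw [Matrix.mul_add, ← Matrix.mul_assoc, hL, Matrix.zero_mul, add_zero]
  have hleft : (A + L * H)ᵀ * S = Aᵀ * S := by
    have hSt : Sᵀ = S := by simpa using hS.eq
    simpa [hSt] using congrArg transpose hright
  rw [Matrix.mul_assoc, hright, ← Matrix.mul_assoc, hleft]

variable {ι : Type*} [Fintype ι] {P : Matrix ι ι ℝ} {μ : ι → ℝ}

lemma trace_mul_eq_zero_of_totalTrace_mul_eq_zero {κ : Type*} [Fintype κ] {U V : Tuple ι κ}
    (hU : 0 ≤ U) (hV : 0 ≤ V) (h : totalTrace (U * V) = 0) (i : ι) : (U i * V i).trace = 0 := by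
  rw [totalTrace_apply] at h
  exact (Finset.sum_eq_zero_iff_of_nonneg fun i _ =>
    trace_mul_nonneg (hU i).posSemidef (hV i).posSemidef).1 h i (Finset.mem_univ i)

lemma sum_smul_average_transpose {κ : Type*} (hst : μ ᵥ* P = μ) (U : Tuple ι κ) :
    ∑ i, μ i • average Pᵀ U i = ∑ i, μ i • U i := by
  simp only [average_apply, transpose_apply, Finset.smul_sum, smul_smul]
  rw [Finset.sum_comm]
  refine Finset.sum_congr rfl fun j _ => ?_
  rw [← Finset.sum_smul]
  congr 1
  exact congrFun hst j

lemma sum_smul_ne_zero {κ : Type*} [Finite κ] (hμ : ∀ i, 0 < μ i) {U : Tuple ι κ} (hU : 0 ≤ U)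
    (hU0 : U ≠ 0) : ∑ i, μ i • U i ≠ 0 := fun h => by
  have := Fintype.ofFinite κ
  refine hU0 (funext fun i => ?_)
  have hi := (Finset.sum_eq_zero_iff_of_nonneg fun i _ => smul_nonneg (hμ i).le (hU i)).1 h i
    (Finset.mem_univ i)
  exact (smul_eq_zero.1 hi).resolve_left (hμ i).ne'

variable {m n : ℕ} {A Q : Matrix (Fin n) (Fin n) ℝ} {H : ι → Matrix (Fin m) (Fin n) ℝ}
  {R : Matrix (Fin m) (Fin m) ℝ} {L : ι → Matrix (Fin n) (Fin m) ℝ} {F U W Y N : Tuple ι (Fin n)}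

lemma totalTrace_average_transpose_mul_eq_zero (hU : jumpAdjoint P F U = U)
    (hY : jumpOperator P F Y + average P N = Y) : totalTrace (average Pᵀ U * N) = 0 := by
  have hsum : totalTrace (U * Y) + totalTrace (average Pᵀ U * N) = totalTrace (U * Y) :=
    calc totalTrace (U * Y) + totalTrace (average Pᵀ U * N)
        = totalTrace (U * jumpOperator P F Y) + totalTrace (U * average P N) := by
          rw [isTraceAdjoint_jumpOperator P F, hU, isTraceAdjoint_average P]
      _ = totalTrace (U * Y) := by rw [← map_add, ← mul_add, hY]
  exact add_eq_left.1 hsum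

lemma mul_eq_zero_of_totalTrace_mul_noise_eq_zero (hQ : Q.PosSemidef) (hR : R.PosDef)
    (hμ : ∀ i, 0 < μ i) (hW : 0 ≤ W) (h : totalTrace (W * noise Q R μ L) = 0) (i : ι) :
    W i * L i = 0 ∧ W i * Q = 0 := by
  have htrace : μ i * ((W i * (L i * R * (L i)ᵀ)).trace + (W i * Q).trace) = 0 := by
    simpa [noise, mul_add] using trace_mul_eq_zero_of_totalTrace_mul_eq_zero hW
      (noise_nonneg hQ.nonneg hR.posSemidef fun i => (hμ i).le) h i
  have hWi := (hW i).posSemidef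
  have hboth := (add_eq_zero_iff_of_nonneg
    (trace_mul_nonneg hWi (posSemidef_mul_mul_transpose hR.posSemidef (L i)))
    (trace_mul_nonneg hWi hQ)).1 ((mul_eq_zero.1 htrace).resolve_left (hμ i).ne')
  exact ⟨mul_eq_zero_of_trace_mul_conj_posDef_eq_zero hWi hR hboth.1,
    mul_eq_zero_of_trace_mul_eq_zero hWi hQ hboth.2⟩

lemma mul_add_gain_eq_zero_of_totalTrace_mul_excess_eq_zero (hR : R.PosDef) (hμ : ∀ i, 0 < μ i)
    (hY : 0 ≤ Y) (hW : 0 ≤ W) (h : totalTrace (W * excess A H R μ L Y) = 0) (i : ι) :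
    W i * (L i + gain A H R μ Y i) = 0 :=
  mul_eq_zero_of_trace_mul_conj_posDef_eq_zero (hW i).posSemidef (posDef_innovation hR hμ hY i)
    (trace_mul_eq_zero_of_totalTrace_mul_eq_zero hW (excess_nonneg hR hμ hY) h i)

-- Pairing the Riccati equation with `U` leaves only the noise, whose pairing with the averages `W`
-- of `U` must vanish; so `L` and `Q` are invisible to `W`, and `∑ i, μ i • U i` is the form.
theorem hasInvariantForm_of_jumpAdjoint_eq (hP : ∀ i j, 0 ≤ P i j) (hμ : ∀ i, 0 < μ i)
    (hst : μ ᵥ* P = μ) (hQ : Q.PosSemidef) (hR : R.PosDef)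
    (hY : average P (covUpdate A H Q R μ L Y) = Y) (hU : 0 ≤ U) (hU0 : U ≠ 0)
    (hfix : jumpAdjoint P (closedLoop A H L) U = U) : HasInvariantForm A Q := by
  set W : Tuple ι (Fin n) := average Pᵀ U with hWdef
  have hW : 0 ≤ W := average_nonneg (fun i j => hP j i) hU
  have hannih := mul_eq_zero_of_totalTrace_mul_noise_eq_zero hQ hR hμ hW
    (totalTrace_average_transpose_mul_eq_zero hfix (average_covUpdate.symm.trans hY))
  have hUW (i : ι) : Aᵀ * W i * A = U i := by
    rw [← transpose_mul_mul_add_mul_of_mul_eq_zero (hW i).posSemidef.isHermitian (hannih i).1 A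
      (H i)]
    exact congrFun hfix i
  refine ⟨∑ i, μ i • U i, posSemidef_sum _ fun i _ => (hU i).posSemidef.smul (hμ i).le,
    sum_smul_ne_zero hμ hU hU0, ?_, ?_⟩
  · rw [conjTranspose_eq_transpose_of_trivial, ← sum_smul_average_transpose hst U, ← hWdef]
    simp only [Finset.mul_sum, Finset.sum_mul, mul_smul_comm, smul_mul_assoc, hUW]
    exact (sum_smul_average_transpose hst U).symm
  · rw [← sum_smul_average_transpose hst U, ← hWdef]
    simp only [Finset.sum_mul, smul_mul_assoc, hannih, smul_zero, Finset.sum_const_zero]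

lemma average_transpose_const {κ : Type*} (hP : P *ᵥ 1 = 1) (S : Matrix κ κ ℝ) :
    average Pᵀ (fun _ => S) = fun _ => S := by
  simpa using average_smul_const (P := Pᵀ) ((vecMul_transpose P 1).trans hP) S

lemma jumpAdjoint_closedLoop_const (hP : P *ᵥ 1 = 1) {S : Matrix (Fin n) (Fin n) ℝ}
    (hS : S.IsHermitian) (hA : Aᵀ * S * A = S) (hL : ∀ i, S * L i = 0) :
    jumpAdjoint P (closedLoop A H L) (fun _ => S) = fun _ => S := by
  funext i
  calc jumpAdjoint P (closedLoop A H L) (fun _ => S) i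
      = (closedLoop A H L i)ᵀ * average Pᵀ (fun _ => S) i * closedLoop A H L i := rfl
    _ = (A + L i * H i)ᵀ * S * (A + L i * H i) := by rw [average_transpose_const hP, closedLoop]
    _ = S := (transpose_mul_mul_add_mul_of_mul_eq_zero hS (hL i) A (H i)).trans hA

lemma mul_gain_eq_zero_of_solvesCARE (hP : P *ᵥ 1 = 1) (hμ : ∀ i, 0 < μ i) (hR : R.PosDef)
    (hY : 0 ≤ Y) (hsol : SolvesCARE A H Q R P μ Y) {S : Matrix (Fin n) (Fin n) ℝ}
    (hS : S.PosSemidef) (hA : Aᵀ * S * A = S) (hQ : S * Q = 0) (i : ι) :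
    S * gain A H R μ Y i = 0 := by
  have hstep : jumpOperator P (closedLoop A H 0) Y
      + average P (noise Q R μ 0 - excess A H R μ 0 Y) = Y := by
    rw [map_sub, ← add_sub_assoc, ← average_covUpdate, ← map_sub,
      sub_eq_of_eq_add (covUpdate_eq_add_excess hR hμ hY)]
    exact (solvesCARE_iff hR hμ hY).1 hsol
  have hpair := totalTrace_average_transpose_mul_eq_zero
    (jumpAdjoint_closedLoop_const hP hS.isHermitian hA fun _ => Matrix.mul_zero S) hstep
  have hnoise : (fun _ => S) * noise Q R μ 0 = 0 := by
    funext i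
    simp [noise, hQ]
  rw [average_transpose_const hP, mul_sub, hnoise, zero_sub, map_neg, neg_eq_zero] at hpair
  simpa using mul_add_gain_eq_zero_of_totalTrace_mul_excess_eq_zero hR hμ hY
    (fun _ => hS.nonneg) hpair i

theorem not_hasInvariantForm_of_solvesCARE [Nonempty ι] (hP : P *ᵥ 1 = 1) (hμ : ∀ i, 0 < μ i)
    (hR : R.PosDef) (hY : 0 ≤ Y) (hsol : SolvesCARE A H Q R P μ Y)
    (hstable : IsSchurStable (jumpOperator P (closedLoop A H (-gain A H R μ Y)))) :
    ¬ HasInvariantForm A Q := by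
  rintro ⟨S, hS, hS0, hA, hQ⟩
  have hfix : jumpAdjoint P (closedLoop A H (-gain A H R μ Y)) (fun _ => S) = fun _ => S :=
    jumpAdjoint_closedLoop_const hP hS.isHermitian hA fun i => by
      rw [Pi.neg_apply, Matrix.mul_neg, mul_gain_eq_zero_of_solvesCARE hP hμ hR hY hsol hS hA hQ,
        neg_zero]
  have hstable' := (isTraceAdjoint_jumpOperator P _).symm.isSchurStable hstable
  exact hS0 (congrFun (hstable'.eq_zero_of_map_eq hfix) (Classical.arbitrary ι))

theorem exists_isMSStabilizingSolution_iff_not_hasInvariantForm [Nonempty ι]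
    (hP : ∀ i j, 0 ≤ P i j) (hone : P *ᵥ 1 = 1) (hμ : ∀ i, 0 < μ i) (hst : μ ᵥ* P = μ)
    (hQ : Q.PosSemidef) (hR : R.PosDef) :
    (∃ Y, IsMSStabilizingSolution A H Q R P μ Y) ↔
      IsMSDetectable H (fun _ => A) P ∧ ¬ HasInvariantForm A Q := by
  constructor
  · rintro ⟨Y, hY, hsol, hstable⟩
    exact ⟨⟨-gain A H R μ Y, hstable⟩, not_hasInvariantForm_of_solvesCARE hone hμ hR
      (fun i => (hY i).nonneg) hsol ((spectralRad_lt_one_iff_isSchurStable _).1 hstable)⟩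
  · rintro ⟨⟨L, hL⟩, hinv⟩
    obtain ⟨Y, hY, hsol, K, hK, hlim⟩ := exists_solvesCARE_of_isSchurStable hP hμ hst hQ hR
      ((spectralRad_lt_one_iff_isSchurStable (jumpOperator P (closedLoop A H L))).1 hL)
    refine ⟨Y, fun i => (hY i).posSemidef, hsol, (spectralRad_lt_one_iff_isSchurStable _).2 ?_⟩
    have hclosed : Continuous fun K : ι → Matrix (Fin n) (Fin m) ℝ => closedLoop A H K := by
      unfold closedLoop
      fun_prop
    refine (isSchurStable_jumpOperator_or_exists_fixed_of_tendsto hP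
      ((hclosed.tendsto _).comp hlim) hK).resolve_right ?_
    rintro ⟨U, hU, hU0, hfix⟩
    exact hinv (hasInvariantForm_of_jumpAdjoint_eq hP hμ hst hQ hR
      ((solvesCARE_iff hR hμ hY).1 hsol) hU hU0 hfix)

end Characterization

section ModeChain

lemma sum_prod_arrival {α : Type*} [CommSemiring α] {m : ℕ} (f : Fin m → Fin 2 → α) :
    ∑ θ : Fin (2 ^ m), ∏ l, f l (arrival θ l) = ∏ l, ∑ s, f l s := by
  rw [Finset.prod_univ_sum, Fintype.piFinset_univ]
  exact Equiv.sum_comp finFunctionFinEquiv.symm fun γ : Fin m → Fin 2 => ∏ l, f l (γ l)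

lemma channelTPM_mem_rowStochastic {p q : ℝ} (hp : p ∈ Set.Icc 0 1) (hq : q ∈ Set.Icc 0 1) :
    channelTPM p q ∈ rowStochastic ℝ (Fin 2) := by
  rw [mem_rowStochastic_iff_sum]
  constructor
  · intro a b
    fin_cases a <;> fin_cases b <;> simp [channelTPM, hp.1, hp.2, hq.1, hq.2]
  · intro a
    fin_cases a <;> simp [channelTPM]

lemma channelDist_pos {p q : ℝ} (hp : 0 < p) (hq : 0 < q) (s : Fin 2) : 0 < channelDist p q s := by
  fin_cases s
  · exact div_pos hp (add_pos hp hq)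
  · exact div_pos hq (add_pos hp hq)

lemma channelDist_vecMul_channelTPM {p q : ℝ} (hpq : p + q ≠ 0) :
    channelDist p q ᵥ* channelTPM p q = channelDist p q := by
  ext s
  fin_cases s <;> simp [vecMul, dotProduct, channelTPM, channelDist] <;> field_simp <;> ring

variable {m : ℕ} {p q : Fin m → ℝ}

lemma modeTPM_mem_rowStochastic (hp : ∀ l, p l ∈ Set.Icc 0 1) (hq : ∀ l, q l ∈ Set.Icc 0 1) :
    modeTPM p q ∈ rowStochastic ℝ (Fin (2 ^ m)) := by
  have hchannel (l : Fin m) := mem_rowStochastic_iff_sum.1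
    (channelTPM_mem_rowStochastic (hp l) (hq l))
  refine mem_rowStochastic_iff_sum.2 ⟨fun i j => ?_, fun i => ?_⟩
  · rw [modeTPM, of_apply]
    exact Finset.prod_nonneg fun l _ => (hchannel l).1 _ _
  · exact (sum_prod_arrival fun l => channelTPM (p l) (q l) (arrival i l)).trans
      (Finset.prod_eq_one fun l _ => (hchannel l).2 _)

lemma modeDist_pos (hp : ∀ l, 0 < p l) (hq : ∀ l, 0 < q l) (i : Fin (2 ^ m)) :
    0 < modeDist p q i :=
  Finset.prod_pos fun l _ => channelDist_pos (hp l) (hq l) _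

lemma modeDist_vecMul_modeTPM (hpq : ∀ l, p l + q l ≠ 0) :
    modeDist p q ᵥ* modeTPM p q = modeDist p q := by
  funext j
  calc (modeDist p q ᵥ* modeTPM p q) j
      = ∑ i, ∏ l, channelDist (p l) (q l) (arrival i l)
          * channelTPM (p l) (q l) (arrival i l) (arrival j l) := by
        simp only [vecMul, dotProduct, modeDist, modeTPM, of_apply, Finset.prod_mul_distrib]
    _ = ∏ l, (channelDist (p l) (q l) ᵥ* channelTPM (p l) (q l)) (arrival j l) :=
        sum_prod_arrival fun l s => channelDist (p l) (q l) s * channelTPM (p l) (q l) s _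
    _ = modeDist p q j := by simp only [channelDist_vecMul_channelTPM (hpq _), modeDist]

end ModeChain

end JumpFilter

end

theorem theorem4_general {ι : Type*} [Fintype ι] [DecidableEq ι] [Nonempty ι] {m n : ℕ}
    (A : Matrix (Fin n) (Fin n) ℝ) (H : ι → Matrix (Fin m) (Fin n) ℝ)
    (Q : Matrix (Fin n) (Fin n) ℝ) (hQ : Q.PosSemidef)
    (R : Matrix (Fin m) (Fin m) ℝ) (hR : R.PosDef)
    (P : Matrix ι ι ℝ) (hP : P ∈ Matrix.rowStochastic ℝ ι)
    (μ : ι → ℝ) (hμ : ∀ i, 0 < μ i) (hst : μ ᵥ* P = μ) :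
    (∃ Y, JumpFilter.IsMSStabilizingSolution A H Q R P μ Y) ↔
      (JumpFilter.IsMSDetectable H (fun _ => A) P ∧
        ∀ z : ℂ, ‖z‖ = 1 →
          (Matrix.fromCols (z • (1 : Matrix (Fin n) (Fin n) ℂ) - A.map Complex.ofReal)
            (Q.map Complex.ofReal)).rank = n) := by
  have hrank := JumpFilter.rank_fromCols_eq_card_iff_not_hasInvariantForm A Q
  rw [Fintype.card_fin] at hrank
  rw [hrank]
  exact JumpFilter.exists_isMSStabilizingSolution_iff_not_hasInvariantForm hP.1 hP.2 hμ hst hQ hR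

theorem theorem4 {m n : ℕ}
    (A : Matrix (Fin n) (Fin n) ℝ) (C : Matrix (Fin m) (Fin n) ℝ)
    (Q : Matrix (Fin n) (Fin n) ℝ) (hQ : Q.PosSemidef)
    (R : Matrix (Fin m) (Fin m) ℝ) (hR : R.PosDef)
    (p q : Fin m → ℝ) (hp : ∀ l, 0 < p l ∧ p l < 1) (hq : ∀ l, 0 < q l ∧ q l < 1) :
    (∃ Y : Fin (2 ^ m) → Matrix (Fin n) (Fin n) ℝ,
      JumpFilter.IsMSStabilizingSolution A (JumpFilter.modeOutput C) Q R
        (JumpFilter.modeTPM p q) (JumpFilter.modeDist p q) Y) ↔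
    (JumpFilter.IsMSDetectable (JumpFilter.modeOutput C) (fun _ => A) (JumpFilter.modeTPM p q) ∧
      ∀ z : ℂ, ‖z‖ = 1 →
        (Matrix.fromCols (z • (1 : Matrix (Fin n) (Fin n) ℂ) - A.map Complex.ofReal)
          (Q.map Complex.ofReal)).rank = n) :=
  theorem4_general A (JumpFilter.modeOutput C) Q hQ R hR _
    (JumpFilter.modeTPM_mem_rowStochastic (fun l => ⟨(hp l).1.le, (hp l).2.le⟩)
      fun l => ⟨(hq l).1.le, (hq l).2.le⟩) _
    (JumpFilter.modeDist_pos (fun l => (hp l).1) fun l => (hq l).1)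
    (JumpFilter.modeDist_vecMul_modeTPM fun l => (add_pos (hp l).1 (hq l).1).ne')
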